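/- **Setting.** Let $K,L,A,B$ be non-empty finite sets, $\lambda\in(0,1]$, $G_{k,l}(a,b)\ge 0$, and let $P_{a,b}(k,\cdot)\in\Delta(K)$, $Q_{a,b}(l,\cdot)\in\Delta(L)$ be transition probabilities. In an $n$-stage game with initial laws $p\in\Delta(K)$, $q\in\Delta(L)$, the states $k_1\sim p$ and $l_1\sim q$ are independent; at stage $t$ player 1, knowing $\mathcal I_t=(k_1,a_1,b_1,\dots,a_{t-1},b_{t-1},k_t)$, draws $a_t$ from $\sigma_t(\mathcal I_t)\in\Delta(A)$ and player 2, knowing $\mathcal J_t=(l_1,a_1,b_1,\dots,a_{t-1},b_{t-1},l_t)$, independently draws $b_t$ from $\tau_t(\mathcal J_t)\in\Delta(B)$; then $k_{t+1}\sim P_{a_t,b_t}(k_t,\cdot)$ and $l_{t+1}\sim Q_{a_t,b_t}(l_t,\cdot)$ independently. Player 1 maximizes and player 2 minimizes. In the type 1 dual game $\tilde\Gamma^1_{n,\lambda}(\mu,q)$ ($\mu\in\mathbb R^K$, $q\in\Delta(L)$) player 1 chooses $(p,\sigma)$, player 2 chooses $\tau$, and the payoff is $E_{p,q,\sigma,\tau}\big[\mu(k_1)+\sum_{t=1}^n\lambda^{t-1}G_{k_t,l_t}(a_t,b_t)\big]$.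 In the type 2 dual game $\tilde\Gamma^2_{n,\lambda}(p,\nu)$ ($p\in\Delta(K)$, $\nu\in\mathbb R^L$) player 1 chooses $\sigma$, player 2 chooses $(q,\tau)$, and the payoff is $E_{p,q,\sigma,\tau}\big[\nu(l_1)+\sum_{t=1}^n\lambda^{t-1}G_{k_t,l_t}(a_t,b_t)\big]$. A strategy is optimal if it guarantees the value. For $Y:L\to\Delta(B)$, written $Y(b,l)$, put $\bar y_{q,Y}(b)=\sum_l q(l)Y(b,l)$, and let $q^+_{q,Y,a,b}(l')=\sum_l Q_{a,b}(l,l')\,q(l)Y(b,l)/\bar y_{q,Y}(b)$ if $\bar y_{q,Y}(b)\neq0$; if $\bar y_{q,Y}(b)=0$, let $q^+_{q,Y,a,b}$ be any prescribed element of $\Delta(L)$ (depending on $a,b$). Define $\bar x_{p,X}(a)=\sum_k p(k)X(a,k)$ and $p^+_{p,X,a,b}\in\Delta(K)$ symmetrically for $X:K\to\Delta(A)$, using $P_{a,b}$. **Theorem.** (0) For every $n\ge0$ the games $\tilde\Gamma^1_{n,\lambda}(\mu,q)$ and $\tilde\Gamma^2_{n,\lambda}(p,\nu)$ have values $w^1_{n,\lambda}(\mu,q)$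 and $w^2_{n,\lambda}(p,\nu)$ ($\max\min=\min\max$, attained). (1) Let $n\ge1$, and let $Y^*$ be the first-stage part of an optimal strategy of player 2 in $\tilde\Gamma^1_{n,\lambda}(\mu,q)$. Then $w^1_{n,\lambda}(\mu,q)$ is the (attained) minimum of $\rho$ over all real $\rho$, $\beta_{a,b}(k)$, $Z_0^{a,b}$, $Z^{a,b}_{\mathcal I_s}$, $S^{a,b}_{\mathcal J_s}(b_s)$ subject to - $\rho\ge\mu(k)+\sum_{l,b}G_{k,l}(a,b)Y^*(b,l)q(l)+\lambda\sum_{l,b}Y^*(b,l)q(l)\big(Z_0^{a,b}-\sum_{k'}P_{a,b}(k,k')\beta_{a,b}(k')\big)$ for all $a,k$; and, for all $a\in A$, $b\in B$, - $\beta_{a,b}(k)+Z^{a,b}_{\mathcal I_1}\le Z_0^{a,b}$ for all $k$, $\mathcal I_1=(k)$; - $\sum_{l_1,\dots,l_s}\sum_{b_s}S^{a,b}_{\mathcal J_s}(b_s)\lambda^{s-1}G_{k_s,l_s}(a_s,b_s)+\sum_{k_{s+1}}\sum_{b_s}P_{a_s,b_s}(k_s,k_{s+1})Z^{a,b}_{\mathcal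 I_{s+1}}\le Z^{a,b}_{\mathcal I_s}$ for $1\le s\le n-1$ and all $\mathcal I_s,a_s$, where $\mathcal J_s$ has the same past actions as $\mathcal I_s$ and $\mathcal I_{s+1}=(\mathcal I_s,a_s,b_s,k_{s+1})$; - $\sum_{b_t}S^{a,b}_{\mathcal J_t}(b_t)=Q_{a_{t-1},b_{t-1}}(l_{t-1},l_t)\,S^{a,b}_{\mathcal J_{t-1}}(b_{t-1})$ for $2\le t\le n-1$ and all $\mathcal J_t=(\mathcal J_{t-1},a_{t-1},b_{t-1},l_t)$; - $\sum_{b_1}S^{a,b}_{\mathcal J_1}(b_1)=q^+_{q,Y^*,a,b}(l_1)$ for all $\mathcal J_1=(l_1)$; - $Z^{a,b}_{\mathcal I_n}=0$ for all $\mathcal I_n$; - $S^{a,b}_{\mathcal J_t}(b_t)\ge0$ for $1\le t\le n-1$ and all $\mathcal J_t,b_t$. Moreover, for every optimal solution of this LP, its component $\beta^*$ gives the next vector payoff $\mu_2=\beta^*_{a_1,b_1}$; that is, $(Y^*,\beta^*)$ is an optimal solution of $$w^1_{n,\lambda}(\mu,q)=\min_Y\min_\beta\max_{\Pi\in\Delta(A\times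 K)}\sum_{a,k}\Pi(a,k)\Big[\mu(k)+\sum_{l,b}G_{k,l}(a,b)Y(b,l)q(l)+\lambda\sum_b\bar y_{q,Y}(b)\Big(w^1_{n-1,\lambda}(\beta_{a,b},q^+_{q,Y,a,b})-\sum_{k'}P_{a,b}(k,k')\beta_{a,b}(k')\Big)\Big].$$ (2) Let $n\ge1$, and let $X^*$ be the first-stage part of an optimal strategy of player 1 in $\tilde\Gamma^2_{n,\lambda}(p,\nu)$. Then $w^2_{n,\lambda}(p,\nu)$ is the (attained) maximum of $\varphi$ over all real $\varphi$, $\alpha_{a,b}(l)$, $U_0^{a,b}$, $U^{a,b}_{\mathcal J_s}$, $R^{a,b}_{\mathcal I_s}(a_s)$ subject to - $\varphi\le\nu(l)+\sum_{k,a}G_{k,l}(a,b)X^*(a,k)p(k)+\lambda\sum_{k,a}X^*(a,k)p(k)\big(U_0^{a,b}-\sum_{l'}Q_{a,b}(l,l')\alpha_{a,b}(l')\big)$ for all $b,l$; and, for all $a\in A$, $b\in B$, - $\alpha_{a,b}(l)+U^{a,b}_{\mathcal J_1}\ge U_0^{a,b}$ for all $l$, $\mathcal J_1=(l)$; - $\sum_{k_1,\dots,k_s}\sum_{a_s}R^{a,b}_{\mathcal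 I_s}(a_s)\lambda^{s-1}G_{k_s,l_s}(a_s,b_s)+\sum_{l_{s+1}}\sum_{a_s}Q_{a_s,b_s}(l_s,l_{s+1})U^{a,b}_{\mathcal J_{s+1}}\ge U^{a,b}_{\mathcal J_s}$ for $1\le s\le n-1$ and all $\mathcal J_s,b_s$, where $\mathcal I_s$ has the same past actions as $\mathcal J_s$ and $\mathcal J_{s+1}=(\mathcal J_s,a_s,b_s,l_{s+1})$; - $\sum_{a_t}R^{a,b}_{\mathcal I_t}(a_t)=P_{a_{t-1},b_{t-1}}(k_{t-1},k_t)\,R^{a,b}_{\mathcal I_{t-1}}(a_{t-1})$ for $2\le t\le n-1$ and all $\mathcal I_t=(\mathcal I_{t-1},a_{t-1},b_{t-1},k_t)$; - $\sum_{a_1}R^{a,b}_{\mathcal I_1}(a_1)=p^+_{p,X^*,a,b}(k_1)$ for all $\mathcal I_1=(k_1)$; - $U^{a,b}_{\mathcal J_n}=0$ for all $\mathcal J_n$; - $R^{a,b}_{\mathcal I_t}(a_t)\ge0$ for $1\le t\le n-1$ and all $\mathcal I_t,a_t$. Moreover, for every optimal solution of this LP, its component $\alpha^*$ gives the next vector payoff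 $\nu_2=\alpha^*_{a_1,b_1}$; that is, $(X^*,\alpha^*)$ is an optimal solution of $$w^2_{n,\lambda}(p,\nu)=\max_X\max_\alpha\min_{\Psi\in\Delta(B\times L)}\sum_{b,l}\Psi(b,l)\Big[\nu(l)+\sum_{k,a}G_{k,l}(a,b)X(a,k)p(k)+\lambda\sum_a\bar x_{p,X}(a)\Big(w^2_{n-1,\lambda}(p^+_{p,X,a,b},\alpha_{a,b})-\sum_{l'}Q_{a,b}(l,l')\alpha_{a,b}(l')\Big)\Big].$$ -/

import Mathlib

/-- The data of a two-player zero-sum stochastic game with incomplete information on both sides: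
`P a b k k'` and `Q a b l l'` are the transition probabilities of the states of players 1 and 2,
`G k l a b` is the one-stage payoff to player 1. -/
structure BayesianGame (K L A B : Type*) [Fintype K] [Fintype L] where
  P : A → B → K → K → ℝ
  Q : A → B → L → L → ℝ
  G : K → L → A → B → ℝ
  P_mem : ∀ a b k, P a b k ∈ stdSimplex ℝ K
  Q_mem : ∀ a b l, Q a b l ∈ stdSimplex ℝ L
  G_nonneg : ∀ k l a b, 0 ≤ G k l a b

/-- Behavioral strategies of a player with states `S` and actions `C`. Stages are numbered from `0`:
at stage `t` the player knows its own states `s 0, …, s t` and the action pairs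
`h 0, …, h (t - 1)` of both players, and it chooses a distribution over its actions. An `n`-stage
payoff only depends on the stages `t < n`. -/
abbrev BehaviorStrategy (S A B C : Type*) [Fintype C] : Type _ :=
  (t : ℕ) → (Fin (t + 1) → S) → (Fin t → A × B) → stdSimplex ℝ C

/-- The stage-one part of a behavioral strategy, `S → Δ(C)`. -/
def BehaviorStrategy.first {S A B C : Type*} [Fintype C] (τ : BehaviorStrategy S A B C) :
    S → stdSimplex ℝ C :=
  fun s => τ 0 (fun _ => s) Fin.elim0

/-! ### Values of zero-sum games and security strategies -/

section ZeroSum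

variable {X Y : Type*}

/-- The minmax level `min_y max_x f x y`, where the `x`-player maximizes `f`. -/
noncomputable def gameValue (f : X → Y → ℝ) : ℝ := ⨅ y, ⨆ x, f x y

/-- `w` is the value of the zero-sum game `f`: `w = max_x min_y f x y = min_y max_x f x y`, all
the extrema that occur at the optimum being attained. -/
def IsGameValue (f : X → Y → ℝ) (w : ℝ) : Prop :=
  IsGreatest {r | ∃ x, IsLeast (Set.range fun y => f x y) r} w ∧
    IsLeast {r | ∃ y, IsGreatest (Set.range fun x => f x y) r} w

/-- `y` is an optimal (security) strategy of the minimizer: `max_x f x y` is the value. -/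
def IsOptimalForMin (f : X → Y → ℝ) (y : Y) : Prop :=
  IsGreatest (Set.range fun x => f x y) (gameValue f)

/-- `x` is an optimal (security) strategy of the maximizer: `min_y f x y` is the value. -/
def IsOptimalForMax (f : X → Y → ℝ) (x : X) : Prop :=
  IsLeast (Set.range fun y => f x y) (gameValue f)

end ZeroSum

/-! ### Beliefs -/

section Belief

variable {S C : Type*} [Fintype S] [Fintype C]

/-- `actProb r Y c = ∑ s, r s * Y(c, s)`: the probability of action `c` when the state has law `r`
and action `c` is taken in state `s` with probability `Y s c`. -/
noncomputable def actProb (r : S → ℝ) (Y : S → stdSimplex ℝ C) (c : C) : ℝ :=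
  ∑ s, r s * (Y s).1 c

/-- The belief about the next state after action `c` was observed, for the transition matrix `T`:
`s' ↦ ∑ s, T s s' * (r s * Y(c, s) / actProb r Y c)`. After an action of probability zero this
is undefined, and the belief is then the given `r₀`. -/
noncomputable def nextBelief (T : S → S → ℝ) (r : S → ℝ) (Y : S → stdSimplex ℝ C) (c : C)
    (r₀ : S → ℝ) (s' : S) : ℝ :=
  if actProb r Y c = 0 then r₀ s' else ∑ s, T s s' * (r s * (Y s).1 c / actProb r Y c)

end Belief

namespace BayesianGame

variable {K L A B : Type*} [Fintype K] [Fintype L] [Fintype A] [Fintype B]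

/-! ### Expected payoffs of the dual games -/

/-- The probability of the play `k 0, l 0, h 0, k 1, l 1, h 1, …, h (n - 1), k n, l n`, where the
initial states are drawn independently from `p` and `q`, the actions `h t = (a, b)` are drawn
independently from the strategies given the information of the players, and each state moves by its
own transition matrix. -/
noncomputable def playProb (g : BayesianGame K L A B) (n : ℕ) (p : K → ℝ) (q : L → ℝ)
    (σ : BehaviorStrategy K A B A) (τ : BehaviorStrategy L A B B)
    (k : Fin (n + 1) → K) (l : Fin (n + 1) → L) (h : Fin n → A × B) : ℝ :=
  p (k 0) * q (l 0) *
    ∏ t : Fin n,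
      ((σ t (fun i => k (Fin.castLE (by omega) i)) (fun i => h (Fin.castLE (by omega) i))).1
          (h t).1 *
        (τ t (fun i => l (Fin.castLE (by omega) i)) (fun i => h (Fin.castLE (by omega) i))).1
          (h t).2 *
        g.P (h t).1 (h t).2 (k t.castSucc) (k t.succ) *
        g.Q (h t).1 (h t).2 (l t.castSucc) (l t.succ))

/-- The expectation `E_{p,q,σ,τ}` of a function of the play of `n` stages. -/
noncomputable def expectation (g : BayesianGame K L A B) (n : ℕ) (p : K → ℝ) (q : L → ℝ)
    (σ : BehaviorStrategy K A B A) (τ : BehaviorStrategy L A B B)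
    (f : (Fin (n + 1) → K) → (Fin (n + 1) → L) → (Fin n → A × B) → ℝ) : ℝ :=
  ∑ k : Fin (n + 1) → K, ∑ l : Fin (n + 1) → L, ∑ h : Fin n → A × B,
    g.playProb n p q σ τ k l h * f k l h

/-- The `lam`-discounted payoff of a play of `n` stages; stage `t` (from `0`) has weight
`lam ^ t`. -/
noncomputable def totalPayoff (g : BayesianGame K L A B) (lam : ℝ) (n : ℕ)
    (k : Fin (n + 1) → K) (l : Fin (n + 1) → L) (h : Fin n → A × B) : ℝ :=
  ∑ t : Fin n, lam ^ (t : ℕ) * g.G (k t.castSucc) (l t.castSucc) (h t).1 (h t).2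

/-- The `n`-stage type 1 dual game: player 1 chooses the law `x.1` of its own initial state and a
strategy `x.2`, player 2 chooses `τ`; the payoff is the expectation of `μ(k_1)` plus the discounted
payoff. -/
noncomputable def dualPayoff1 (g : BayesianGame K L A B) (lam : ℝ) (n : ℕ) (μ : K → ℝ) (q : L → ℝ)
    (x : stdSimplex ℝ K × BehaviorStrategy K A B A) (τ : BehaviorStrategy L A B B) : ℝ :=
  g.expectation n x.1.1 q x.2 τ fun k l h => μ (k 0) + g.totalPayoff lam n k l h

/-- The `n`-stage type 2 dual game: player 2 chooses the law `y.1` of its own initial state and a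
strategy `y.2`, player 1 chooses `σ`; the payoff is the expectation of `ν(l_1)` plus the discounted
payoff. -/
noncomputable def dualPayoff2 (g : BayesianGame K L A B) (lam : ℝ) (n : ℕ) (p : K → ℝ) (ν : L → ℝ)
    (σ : BehaviorStrategy K A B A) (y : stdSimplex ℝ L × BehaviorStrategy L A B B) : ℝ :=
  g.expectation n p y.1.1 σ y.2 fun k l h => ν (l 0) + g.totalPayoff lam n k l h

/-- The value `w¹_{n,lam}(μ, q)` of the type 1 dual game. -/
noncomputable def w1 (g : BayesianGame K L A B) (lam : ℝ) (n : ℕ) (μ : K → ℝ) (q : L → ℝ) : ℝ :=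
  gameValue (g.dualPayoff1 lam n μ q)

/-- The value `w²_{n,lam}(p, ν)` of the type 2 dual game. -/
noncomputable def w2 (g : BayesianGame K L A B) (lam : ℝ) (n : ℕ) (p : K → ℝ) (ν : L → ℝ) : ℝ :=
  gameValue (g.dualPayoff2 lam n p ν)

/-! ### Vector payoffs -/

/-- The belief `q⁺` about player 2's state after the actions `a, b`; `q₀` supplies the beliefs after
actions of probability zero. -/
noncomputable def qNext (g : BayesianGame K L A B) (q₀ : A → B → L → ℝ) (q : L → ℝ)
    (Y : L → stdSimplex ℝ B) (a : A) (b : B) : L → ℝ :=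
  nextBelief (g.Q a b) q Y b (q₀ a b)

/-- The belief `p⁺` about player 1's state after the actions `a, b`; `p₀` supplies the beliefs after
actions of probability zero. -/
noncomputable def pNext (g : BayesianGame K L A B) (p₀ : A → B → K → ℝ) (p : K → ℝ)
    (X : K → stdSimplex ℝ A) (a : A) (b : B) : K → ℝ :=
  nextBelief (g.P a b) p X a (p₀ a b)

/-- The objective `𝔖¹_{μ,q,Y,β,Π}(w)` of the one-stage problem of the type 1 dual game. -/
noncomputable def stageObjective1 (g : BayesianGame K L A B) (lam : ℝ) (q₀ : A → B → L → ℝ)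
    (w : (K → ℝ) → (L → ℝ) → ℝ) (μ : K → ℝ) (q : L → ℝ) (Y : L → stdSimplex ℝ B)
    (β : A → B → K → ℝ) (Pi : stdSimplex ℝ (A × K)) : ℝ :=
  ∑ a, ∑ k, Pi.1 (a, k) *
    (μ k + ∑ l, ∑ b, g.G k l a b * (Y l).1 b * q l +
      lam * ∑ b, actProb q Y b *
        (w (β a b) (g.qNext q₀ q Y a b) - ∑ k', g.P a b k k' * β a b k'))

/-- The objective `𝔖²_{p,ν,X,α,Ψ}(w)` of the one-stage problem of the type 2 dual game. -/
noncomputable def stageObjective2 (g : BayesianGame K L A B) (lam : ℝ) (p₀ : A → B → K → ℝ)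
    (w : (K → ℝ) → (L → ℝ) → ℝ) (p : K → ℝ) (ν : L → ℝ) (X : K → stdSimplex ℝ A)
    (α : A → B → L → ℝ) (Psi : stdSimplex ℝ (B × L)) : ℝ :=
  ∑ b, ∑ l, Psi.1 (b, l) *
    (ν l + ∑ k, ∑ a, g.G k l a b * (X k).1 a * p k +
      lam * ∑ a, actProb p X a *
        (w (g.pNext p₀ p X a b) (α a b) - ∑ l', g.Q a b l l' * α a b l'))

/-- `(Y, β)` is an optimal solution of
`w¹_n(μ, q) = min_Y min_β max_Π 𝔖¹_{μ,q,Y,β,Π}(w¹_{n-1})` (and this equation holds), so that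
`β a b` is a vector payoff of the second stage after the actions `a, b`. -/
def IsVectorPayoff1 (g : BayesianGame K L A B) (lam : ℝ) (n : ℕ) (q₀ : A → B → L → ℝ)
    (μ : K → ℝ) (q : L → ℝ) (Y : L → stdSimplex ℝ B) (β : A → B → K → ℝ) : Prop :=
  IsLeast {r | ∃ Y' β',
      IsGreatest (Set.range (g.stageObjective1 lam q₀ (g.w1 lam (n - 1)) μ q Y' β')) r}
    (g.w1 lam n μ q) ∧
  IsGreatest (Set.range (g.stageObjective1 lam q₀ (g.w1 lam (n - 1)) μ q Y β)) (g.w1 lam n μ q)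

/-- `(X, α)` is an optimal solution of
`w²_n(p, ν) = max_X max_α min_Ψ 𝔖²_{p,ν,X,α,Ψ}(w²_{n-1})` (and this equation holds), so that
`α a b` is a vector payoff of the second stage after the actions `a, b`. -/
def IsVectorPayoff2 (g : BayesianGame K L A B) (lam : ℝ) (n : ℕ) (p₀ : A → B → K → ℝ)
    (p : K → ℝ) (ν : L → ℝ) (X : K → stdSimplex ℝ A) (α : A → B → L → ℝ) : Prop :=
  IsGreatest {r | ∃ X' α',
      IsLeast (Set.range (g.stageObjective2 lam p₀ (g.w2 lam (n - 1)) p ν X' α')) r}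
    (g.w2 lam n p ν) ∧
  IsLeast (Set.range (g.stageObjective2 lam p₀ (g.w2 lam (n - 1)) p ν X α)) (g.w2 lam n p ν)

/-! ### The linear programs

The variables indexed by an information set carry the stage `t` (from `0`), the own states up to
stage `t` and the action pairs before stage `t`; `Fin.snoc` appends a state or an action pair. In
the doc strings below stages are numbered from `1`. -/

/-- Feasibility in the linear program of the type 1 dual game. -/
structure Feasible1 (g : BayesianGame K L A B) (lam : ℝ) (n : ℕ) (q₀ : A → B → L → ℝ)
    (μ : K → ℝ) (q : L → ℝ) (Y : L → stdSimplex ℝ B)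
    (ρ : ℝ) (β : A → B → K → ℝ) (Z₀ : A → B → ℝ)
    (Z : A → B → (t : ℕ) → (Fin (t + 1) → K) → (Fin t → A × B) → ℝ)
    (S : A → B → (t : ℕ) → (Fin (t + 1) → L) → (Fin t → A × B) → B → ℝ) : Prop where
  /-- the bound on `ρ`, for all `a, k` -/
  objective : ∀ a k,
    μ k + ∑ l, ∑ b, g.G k l a b * (Y l).1 b * q l +
      lam * ∑ l, ∑ b, (Y l).1 b * q l * (Z₀ a b - ∑ k', g.P a b k k' * β a b k') ≤ ρ
  /-- `β_{a,b}(k) + Z^{a,b}_{(k)} ≤ Z₀^{a,b}` -/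
  initial : ∀ a b k, β a b k + Z a b 0 (fun _ => k) Fin.elim0 ≤ Z₀ a b
  /-- the inequalities for `Z` at the stages `1, …, n - 1` -/
  step : ∀ a b (s : ℕ), s + 1 < n → ∀ (k : Fin (s + 1) → K) (h : Fin s → A × B) (a' : A),
    ∑ l : Fin (s + 1) → L, ∑ b', S a b s l h b' * lam ^ s *
        g.G (k (Fin.last s)) (l (Fin.last s)) a' b' +
      ∑ k', ∑ b', g.P a' b' (k (Fin.last s)) k' *
        Z a b (s + 1) (Fin.snoc (α := fun _ => K) k k')
          (Fin.snoc (α := fun _ => A × B) h (a', b')) ≤ Z a b s k h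
  /-- the equations for `S` at the stages `2, …, n - 1` -/
  flow : ∀ a b (t : ℕ), t + 2 < n → ∀ (l : Fin (t + 1) → L) (h : Fin t → A × B)
    (a' : A) (b' : B) (l' : L),
    ∑ b'', S a b (t + 1) (Fin.snoc (α := fun _ => L) l l')
        (Fin.snoc (α := fun _ => A × B) h (a', b')) b'' =
      g.Q a' b' (l (Fin.last t)) l' * S a b t l h b'
  /-- the equations for `S` at stage `1` -/
  flow_one : ∀ a b l, ∑ b', S a b 0 (fun _ => l) Fin.elim0 b' = g.qNext q₀ q Y a b l
  /-- `Z` vanishes at stage `n` -/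
  terminal : ∀ a b k h, Z a b (n - 1) k h = 0
  /-- `S` is nonnegative at the stages `1, …, n - 1` -/
  nonneg : ∀ a b (t : ℕ), t + 1 < n → ∀ l h b', 0 ≤ S a b t l h b'

/-- Feasibility in the linear program of the type 2 dual game. -/
structure Feasible2 (g : BayesianGame K L A B) (lam : ℝ) (n : ℕ) (p₀ : A → B → K → ℝ)
    (p : K → ℝ) (ν : L → ℝ) (X : K → stdSimplex ℝ A)
    (φ : ℝ) (α : A → B → L → ℝ) (U₀ : A → B → ℝ)
    (U : A → B → (t : ℕ) → (Fin (t + 1) → L) → (Fin t → A × B) → ℝ)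
    (R : A → B → (t : ℕ) → (Fin (t + 1) → K) → (Fin t → A × B) → A → ℝ) : Prop where
  /-- the bound on `φ`, for all `b, l` -/
  objective : ∀ b l,
    φ ≤ ν l + ∑ k, ∑ a, g.G k l a b * (X k).1 a * p k +
      lam * ∑ k, ∑ a, (X k).1 a * p k * (U₀ a b - ∑ l', g.Q a b l l' * α a b l')
  /-- `α_{a,b}(l) + U^{a,b}_{(l)} ≥ U₀^{a,b}` -/
  initial : ∀ a b l, U₀ a b ≤ α a b l + U a b 0 (fun _ => l) Fin.elim0
  /-- the inequalities for `U` at the stages `1, …, n - 1` -/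
  step : ∀ a b (s : ℕ), s + 1 < n → ∀ (l : Fin (s + 1) → L) (h : Fin s → A × B) (b' : B),
    U a b s l h ≤
      ∑ k : Fin (s + 1) → K, ∑ a', R a b s k h a' * lam ^ s *
          g.G (k (Fin.last s)) (l (Fin.last s)) a' b' +
        ∑ l', ∑ a', g.Q a' b' (l (Fin.last s)) l' *
          U a b (s + 1) (Fin.snoc (α := fun _ => L) l l')
            (Fin.snoc (α := fun _ => A × B) h (a', b'))
  /-- the equations for `R` at the stages `2, …, n - 1` -/
  flow : ∀ a b (t : ℕ), t + 2 < n → ∀ (k : Fin (t + 1) → K) (h : Fin t → A × B)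
    (a' : A) (b' : B) (k' : K),
    ∑ a'', R a b (t + 1) (Fin.snoc (α := fun _ => K) k k')
        (Fin.snoc (α := fun _ => A × B) h (a', b')) a'' =
      g.P a' b' (k (Fin.last t)) k' * R a b t k h a'
  /-- the equations for `R` at stage `1` -/
  flow_one : ∀ a b k, ∑ a', R a b 0 (fun _ => k) Fin.elim0 a' = g.pNext p₀ p X a b k
  /-- `U` vanishes at stage `n` -/
  terminal : ∀ a b l h, U a b (n - 1) l h = 0
  /-- `R` is nonnegative at the stages `1, …, n - 1` -/
  nonneg : ∀ a b (t : ℕ), t + 1 < n → ∀ k h a', 0 ≤ R a b t k h a'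

end BayesianGame

/-! The payoff is bilinear in the players' realization plans, the products of a player's own action
and transition probabilities along a history (`BayesianGame.expectation_payoff`). Truncated plans
with laws in a compact convex set form a compact convex set. Sion's theorem gives a saddle point of
plans, and normalizing the weights (`IsPlan.exists_realization`) turns plans back into strategies.
This yields the values (`PlanGame.exists_saddle`).

The linear program rests on the duality between plans and Bellman inequalities. Against a fixed plan
`S` the maximizer faces a Markov decision problem, and `Z` bounds its values at the information
sets. By `PlanGame.pay_eq` the payoff is the initial value minus a weighted sum of slacks, so
feasible `Z` give upper bounds, and backward induction gives a reply without slack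
(`PlanGame.exists_bestReply`). Hence the constraints for one pair of actions say that `S` holds the
dual game with vector payoff `β`, started from the updated belief, to at most `Z₀`.

The first stage is then glued on. Playing `Y` and continuing with strategies that realize the `S`
guarantees `ρ` (`PlanGame.Feasible.value_le`). Conversely, a strategy that guarantees `ρ` is cut
after its first stage and rescaled by the action probabilities; `β` is minus the best-reply values
and `Z₀` is zero (`PlanGame.exists_feasible`). At an optimum, replacing `Z₀` by the continuation
value can only lower the one-stage objective, while `PlanGame.value_le_of_isGreatest` forbids
falling below the value; so the `β` component is optimal in the recursion.

The type 2 game is the type 1 game with the players exchanged and the payoff negated. `PlanGame`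
covers both cases. -/

open Finset

/-! ### Sums over histories -/

section Tuples

variable {S : Type*} [Fintype S]

theorem sum_snoc_tuple {n : ℕ} (F : (Fin (n + 1) → S) → ℝ) :
    ∑ s, F s = ∑ s : Fin n → S, ∑ s', F (Fin.snoc (α := fun _ => S) s s') := by
  rw [← (Fin.snocEquiv fun _ => S).sum_comp, Fintype.sum_prod_type, sum_comm]
  rfl

theorem sum_cons_tuple {n : ℕ} (F : (Fin (n + 1) → S) → ℝ) :
    ∑ s, F s = ∑ s₀, ∑ s : Fin n → S, F (Fin.cons (α := fun _ => S) s₀ s) := by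
  rw [← (Fin.consEquiv fun _ => S).sum_comp, Fintype.sum_prod_type]
  rfl

theorem sum_tuple_one (F : (Fin 1 → S) → ℝ) : ∑ s, F s = ∑ s₀, F fun _ => s₀ := by
  rw [← (Equiv.funUnique (Fin 1) S).symm.sum_comp]
  rfl

theorem sum_tuple_zero (F : (Fin 0 → S) → ℝ) : ∑ s, F s = F Fin.elim0 := by
  rw [Fintype.sum_unique]
  congr 1

end Tuples

/-! ### Realization plans -/

section Plans

variable {S A B M : Type*}

/-- Weights of the information sets and own actions of a player with states `S` and
actions `M`. -/
abbrev Plan (S A B M : Type*) : Type _ :=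
  (t : ℕ) → (Fin (t + 1) → S) → (Fin t → A × B) → M → ℝ

/-- Realization plans for the stages `t < n`, where `r` is the law of the initial state, `T` the
transition matrix and `π` the own component of a pair of actions. -/
structure IsPlan [Fintype M] (n : ℕ) (T : A × B → S → S → ℝ) (π : A × B → M) (r : S → ℝ)
    (y : Plan S A B M) : Prop where
  nonneg : ∀ t < n, ∀ s h m, 0 ≤ y t s h m
  init : 0 < n → ∀ s, ∑ m, y 0 (fun _ => s) Fin.elim0 m = r s
  flow : ∀ t, t + 1 < n → ∀ s h c s',
    ∑ m, y (t + 1) (Fin.snoc (α := fun _ => S) s s') (Fin.snoc (α := fun _ => A × B) h c) m =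
      T c (s (Fin.last t)) s' * y t s h (π c)

namespace BehaviorStrategy

variable [Fintype M]

/-- The own contribution to the probability of an information set. -/
noncomputable def reach (T : A × B → S → S → ℝ) (π : A × B → M) (r : S → ℝ)
    (τ : BehaviorStrategy S A B M) (t : ℕ) (s : Fin (t + 1) → S) (h : Fin t → A × B) : ℝ :=
  r (s 0) * ∏ i : Fin t,
    ((τ i (fun j => s (Fin.castLE (by omega) j)) (fun j => h (Fin.castLE (by omega) j))).1
      (π (h i)) * T (h i) (s i.castSucc) (s i.succ))

/-- The realization plan of a behavioral strategy. -/
noncomputable def realization (T : A × B → S → S → ℝ) (π : A × B → M) (r : S → ℝ)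
    (τ : BehaviorStrategy S A B M) : Plan S A B M :=
  fun t s h m => reach T π r τ t s h * (τ t s h).1 m

/-- The continuation of a strategy after the first stage. -/
def tail (τ : BehaviorStrategy S A B M) (s₀ : S) (c : A × B) : BehaviorStrategy S A B M :=
  fun t s h => τ (t + 1) (Fin.cons (α := fun _ => S) s₀ s) (Fin.cons (α := fun _ => A × B) c h)

/-- The strategy that plays `X` at the first stage and continues with `σ c` after the actions `c`. -/
def compose (X : S → stdSimplex ℝ M) (σ : A × B → BehaviorStrategy S A B M) :
    BehaviorStrategy S A B M
  | 0, s, _ => X (s 0)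
  | t + 1, s, h => σ (h 0) t (Fin.tail s) (Fin.tail h)

variable (T : A × B → S → S → ℝ) (π : A × B → M) (r : S → ℝ) (τ : BehaviorStrategy S A B M)

theorem compose_first (X : S → stdSimplex ℝ M) (σ : A × B → BehaviorStrategy S A B M) :
    (compose X σ).first = X := rfl

theorem tail_compose (X : S → stdSimplex ℝ M) (σ : A × B → BehaviorStrategy S A B M) (s₀ : S)
    (c : A × B) : (compose X σ).tail s₀ c = σ c := rfl

theorem reach_zero (s : Fin 1 → S) (h : Fin 0 → A × B) : reach T π r τ 0 s h = r (s 0) := by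
  simp [reach]

theorem realization_zero (s : S) (h : Fin 0 → A × B) (m : M) :
    realization T π r τ 0 (fun _ => s) h m = r s * (τ.first s).1 m := by
  rw [realization, reach_zero, first, Subsingleton.elim h Fin.elim0]

theorem reach_snoc (t : ℕ) (s : Fin (t + 1) → S) (h : Fin t → A × B) (s' : S) (c : A × B) :
    reach T π r τ (t + 1) (Fin.snoc (α := fun _ => S) s s')
      (Fin.snoc (α := fun _ => A × B) h c) =
        T c (s (Fin.last t)) s' * realization T π r τ t s h (π c) := by
  -- Whatever depends only on the history up to stage `u ≤ t` does not see the appended entries.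
  -- This is used for the factors `i < t` and for the new factor `t`.
  have key (u : ℕ) (hu : u ≤ t) (φ : (Fin (u + 1) → S) → (Fin u → A × B) → ℝ) :
      φ (fun j => Fin.snoc (α := fun _ => S) s s'
          (Fin.castLE ((Nat.succ_le_succ hu).trans (Nat.le_succ _)) j))
        (fun j => Fin.snoc (α := fun _ => A × B) h c (Fin.castLE (hu.trans (Nat.le_succ _)) j)) =
      φ (fun j => s (Fin.castLE (Nat.succ_le_succ hu) j)) (fun j => h (Fin.castLE hu j)) := by
    congr 1 <;> funext j
    · exact Fin.snoc_castSucc (α := fun _ => S) s' s (Fin.castLE (Nat.succ_le_succ hu) j)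
    · exact Fin.snoc_castSucc (α := fun _ => A × B) c h (Fin.castLE hu j)
  have h0 : Fin.snoc (α := fun _ => S) s s' 0 = s 0 :=
    Fin.snoc_castSucc (α := fun _ => S) s' s 0
  rw [reach, realization, reach, Fin.prod_univ_castSucc, h0]
  simp only [Fin.snoc_castSucc, Fin.snoc_last, ← Fin.castSucc_succ, Fin.succ_last]
  have hl := key t le_rfl (fun a b => (τ t a b).1 (π c))
  have hi : ∀ i : Fin t, _ := fun i => key i i.2.le (fun a b => (τ i a b).1 (π (h i)))
  have e : ∀ x y z u v w : ℝ, x = y → u = v → z * (x * (u * w)) = w * (z * y * v) := by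
    rintro x _ z u _ w rfl rfl
    ring
  exact e _ _ _ _ _ _ (prod_congr rfl fun i _ => congrArg (· * _) (hi i)) hl

/-- The first factor of the product is absorbed into an unnormalized initial law of the tail
strategy. The induction peels off the last stage, where `reach_snoc` applies. -/
theorem realization_cons (t : ℕ) (s : Fin (t + 1) → S) (h : Fin t → A × B) (s₀ : S) (c : A × B)
    (m : M) :
    realization T π r τ (t + 1) (Fin.cons (α := fun _ => S) s₀ s)
      (Fin.cons (α := fun _ => A × B) c h) m =
        realization T π (fun s' => r s₀ * (τ.first s₀).1 (π c) * T c s₀ s') (τ.tail s₀ c)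
          t s h m := by
  induction t generalizing m with
  | zero =>
    have e1 : s = fun _ => s 0 := funext fun i => congrArg s (Fin.fin_one_eq_zero i)
    have e2 : h = Fin.elim0 := Subsingleton.elim _ _
    rw [realization, e1]
    have := reach_snoc T π r τ 0 (fun _ => s₀) Fin.elim0 (s 0) c
    have e3 : (Fin.cons s₀ fun _ => s 0 : Fin 2 → S) =
        Fin.snoc (α := fun _ => S) (n := 1) (fun _ => s₀) (s 0) := by
      funext i; fin_cases i <;> rfl
    have e4 : (Fin.cons c h : Fin 1 → A × B) =
        Fin.snoc (α := fun _ => A × B) (n := 0) Fin.elim0 c := by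
      funext i; fin_cases i; rfl
    rw [e3, e4, this, realization_zero, realization, reach_zero, tail, e3, e2, ← e4, e2]
    ring
  | succ t ih =>
    obtain ⟨s, s', rfl⟩ : ∃ u u', s = Fin.snoc (α := fun _ => S) u u' :=
      ⟨Fin.init s, s (Fin.last _), (Fin.snoc_init_self s).symm⟩
    obtain ⟨h, c', rfl⟩ : ∃ u u', h = Fin.snoc (α := fun _ => A × B) u u' :=
      ⟨Fin.init h, h (Fin.last _), (Fin.snoc_init_self h).symm⟩
    have e1 := Fin.cons_snoc_eq_snoc_cons s₀ s s'
    have e2 := Fin.cons_snoc_eq_snoc_cons c h c'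
    rw [realization, realization, tail, reach_snoc, ← ih, e1, e2, reach_snoc]
    congr 2

theorem realization_nonneg (hT : ∀ c s s', 0 ≤ T c s s') (hr : ∀ s, 0 ≤ r s) (t : ℕ)
    (s : Fin (t + 1) → S) (h : Fin t → A × B) (m : M) : 0 ≤ realization T π r τ t s h m :=
  mul_nonneg (mul_nonneg (hr _) (prod_nonneg fun _ _ => mul_nonneg ((τ _ _ _).2.1 _) (hT _ _ _)))
    ((τ _ _ _).2.1 _)

theorem sum_realization (t : ℕ) (s : Fin (t + 1) → S) (h : Fin t → A × B) :
    ∑ m, realization T π r τ t s h m = reach T π r τ t s h := by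
  simp only [realization, ← mul_sum, (τ t s h).2.2, mul_one]

theorem isPlan_realization (n : ℕ) (hT : ∀ c s s', 0 ≤ T c s s') (hr : ∀ s, 0 ≤ r s) :
    IsPlan n T π r (realization T π r τ) where
  nonneg _ _ := realization_nonneg T π r τ hT hr _
  init _ s := by rw [sum_realization, reach_zero]
  flow t _ s h c s' := by rw [sum_realization, reach_snoc]

theorem realization_of_eq_zero (hr : ∀ s, r s = 0) (t : ℕ) (s : Fin (t + 1) → S)
    (h : Fin t → A × B) (m : M) : realization T π r τ t s h m = 0 := by
  simp [realization, reach, hr]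

end BehaviorStrategy

open BehaviorStrategy

/-- A nonnegative vector is a multiple of a point of the simplex. -/
theorem exists_mem_stdSimplex_smul [Fintype M] [Nonempty M] (v : M → ℝ) (hv : ∀ m, 0 ≤ v m) :
    ∃ x : stdSimplex ℝ M, ∀ m, v m = (∑ m', v m') * x.1 m := by
  classical
  by_cases h : ∑ m', v m' = 0
  · obtain ⟨m₀⟩ := ‹Nonempty M›
    refine ⟨⟨Pi.single m₀ 1, single_mem_stdSimplex ℝ m₀⟩, fun m => ?_⟩
    rw [h, zero_mul]
    exact (sum_eq_zero_iff_of_nonneg fun i _ => hv i).1 h m (mem_univ m)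
  · refine ⟨⟨fun m => v m / ∑ m', v m', fun m => div_nonneg (hv m) (sum_nonneg fun i _ => hv i),
      ?_⟩, fun m => ?_⟩
    · rw [← sum_div, div_self h]
    · field_simp

/-- Realization plans are realized by behavioral strategies. -/
theorem IsPlan.exists_realization [Fintype M] [Nonempty M] {n : ℕ} {T : A × B → S → S → ℝ}
    {π : A × B → M} {r : S → ℝ} {y : Plan S A B M} (hy : IsPlan n T π r y) :
    ∃ τ : BehaviorStrategy S A B M, ∀ t < n, realization T π r τ t = y t := by
  -- The behavior at an information set is its normalized weight vector. It is arbitrary where the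
  -- weight is zero and from stage `n` on.
  have ex (t : ℕ) (s : Fin (t + 1) → S) (h : Fin t → A × B) :
      ∃ x : stdSimplex ℝ M, t < n → ∀ m, y t s h m = (∑ m', y t s h m') * x.1 m := by
    by_cases ht : t < n
    · obtain ⟨x, hx⟩ := exists_mem_stdSimplex_smul (y t s h) (hy.nonneg t ht s h)
      exact ⟨x, fun _ => hx⟩
    · obtain ⟨x, -⟩ := exists_mem_stdSimplex_smul (fun _ : M => (0 : ℝ)) fun _ => le_rfl
      exact ⟨x, fun h => absurd h ht⟩
  choose τ hτ using ex
  refine ⟨τ, fun t => ?_⟩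
  induction t with
  | zero =>
    intro ht
    funext s h m
    have e1 : s = fun _ => s 0 := funext fun i => congrArg s (Fin.fin_one_eq_zero i)
    rw [hτ 0 s h ht m, realization, reach_zero, Subsingleton.elim h Fin.elim0, e1, hy.init ht]
  | succ t ih =>
    intro ht
    funext s h m
    obtain ⟨s, s', rfl⟩ : ∃ u u', s = Fin.snoc (α := fun _ => S) u u' :=
      ⟨Fin.init s, s (Fin.last _), (Fin.snoc_init_self s).symm⟩
    obtain ⟨h, c', rfl⟩ : ∃ u u', h = Fin.snoc (α := fun _ => A × B) u u' :=
      ⟨Fin.init h, h (Fin.last _), (Fin.snoc_init_self h).symm⟩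
    rw [hτ _ _ _ ht m, realization, reach_snoc, ih (by omega), hy.flow t ht]

/-- The plan after the first stage, for the actions `c` at the first stage. -/
noncomputable def Plan.shift [Fintype S] (y : Plan S A B M) (c : A × B) : Plan S A B M :=
  fun t s h m => ∑ s₀, y (t + 1) (Fin.cons (α := fun _ => S) s₀ s)
    (Fin.cons (α := fun _ => A × B) c h) m

theorem BehaviorStrategy.realization_smul [Fintype M] (T : A × B → S → S → ℝ) (π : A × B → M) (r : S → ℝ) (x : ℝ)
    (τ : BehaviorStrategy S A B M) (t : ℕ) (s : Fin (t + 1) → S) (h : Fin t → A × B) (m : M) :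
    realization T π (fun s => x * r s) τ t s h m = x * realization T π r τ t s h m := by
  simp only [realization, reach, mul_assoc]

variable [Fintype S] [Fintype M]

/-- The initial state can be summed out because later rewards see only the current state. The new
law is unnormalized: it carries the weight of the own action in `c`. -/
theorem IsPlan.shift {n : ℕ} {T : A × B → S → S → ℝ} {π : A × B → M} {r : S → ℝ}
    {y : Plan S A B M} (hy : IsPlan (n + 1) T π r y) (c : A × B) :
    IsPlan n T π (fun s => ∑ s₀, y 0 (fun _ => s₀) Fin.elim0 (π c) * T c s₀ s) (y.shift c) where
  nonneg t ht s h m := sum_nonneg fun s₀ _ => hy.nonneg _ (by omega) _ _ _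
  init hn s := by
    simp only [Plan.shift]
    rw [sum_comm]
    refine sum_congr rfl fun s₀ _ => ?_
    have e3 : (Fin.cons s₀ fun _ => s : Fin 2 → S) =
        Fin.snoc (α := fun _ => S) (n := 1) (fun _ => s₀) s := by
      funext i; fin_cases i <;> rfl
    have e4 : (Fin.cons c Fin.elim0 : Fin 1 → A × B) =
        Fin.snoc (α := fun _ => A × B) (n := 0) Fin.elim0 c := by
      funext i; fin_cases i; rfl
    rw [e3, e4, hy.flow 0 (by omega), mul_comm]
  flow t ht s h c' s' := by
    simp only [Plan.shift]
    rw [sum_comm, mul_sum]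
    refine sum_congr rfl fun s₀ _ => ?_
    have e1 := Fin.cons_snoc_eq_snoc_cons s₀ s s'
    have e2 := Fin.cons_snoc_eq_snoc_cons c h c'
    rw [e1, e2, hy.flow (t + 1) (by omega)]
    rfl

/-- The continuation `σ c` ignores the first state, so the sum over that state acts on the initial
law alone. -/
theorem shift_realization_compose (T : A × B → S → S → ℝ) (π : A × B → M) (r : S → ℝ)
    (X : S → stdSimplex ℝ M) (σ : A × B → BehaviorStrategy S A B M) (c : A × B) :
    (realization T π r (compose X σ)).shift c =
      realization T π (fun s => ∑ s₀, r s₀ * (X s₀).1 (π c) * T c s₀ s) (σ c) := by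
  funext t s h m
  simp only [Plan.shift, realization_cons, tail_compose, compose_first]
  simp only [realization, reach, sum_mul]

end Plans

/-! ### Games in terms of realization plans -/

/-- A zero-sum stochastic game with incomplete information on both sides between a maximizer with
states `K` and actions `M` and a minimizer with states `L` and actions `N`, whose pairs of actions
are recorded as elements of `A × B`. -/
structure PlanGame (K L A B M N : Type*) [Fintype K] [Fintype L] where
  e : M × N ≃ A × B
  P : A × B → K → K → ℝ
  Q : A × B → L → L → ℝ
  G : K → L → A × B → ℝ
  lam : ℝ
  P_mem : ∀ c k, P c k ∈ stdSimplex ℝ K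
  Q_mem : ∀ c l, Q c l ∈ stdSimplex ℝ L
  lam_nonneg : 0 ≤ lam

namespace PlanGame

open BehaviorStrategy

variable {K L A B M N : Type*} [Fintype K] [Fintype L] [Fintype A] [Fintype B] [Fintype M]
  [Fintype N] (d : PlanGame K L A B M N)

/-- The action of the maximizer in a pair of actions. -/
def act₁ (c : A × B) : M := (d.e.symm c).1

/-- The action of the minimizer in a pair of actions. -/
def act₂ (c : A × B) : N := (d.e.symm c).2

omit [Fintype A] [Fintype B] [Fintype M] [Fintype N] in
@[simp] theorem act₁_e (m : M) (n : N) : d.act₁ (d.e (m, n)) = m := by simp [act₁]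

omit [Fintype A] [Fintype B] [Fintype M] [Fintype N] in
@[simp] theorem act₂_e (m : M) (n : N) : d.act₂ (d.e (m, n)) = n := by simp [act₂]

theorem sum_pairs (F : A × B → ℝ) : ∑ c, F c = ∑ m, ∑ n, F (d.e (m, n)) := by
  rw [← d.e.sum_comp, Fintype.sum_prod_type]

/-- The reward of the maximizer at an information set, against the plan `y`. -/
noncomputable def stageReward (y : Plan L A B N) (t : ℕ) (k : Fin (t + 1) → K)
    (h : Fin t → A × B) (m : M) : ℝ :=
  ∑ l : Fin (t + 1) → L, ∑ n, y t l h n * d.lam ^ t *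
    d.G (k (Fin.last t)) (l (Fin.last t)) (d.e (m, n))

/-- The payoff of a pair of plans in the stages `t < n`. -/
noncomputable def pay (n : ℕ) (x : Plan K A B M) (y : Plan L A B N) : ℝ :=
  ∑ t ∈ range n, ∑ k, ∑ h, ∑ m, x t k h m * d.stageReward y t k h m

/-- The continuation value of an action of the maximizer, where `Z` are the values of the
information sets. -/
noncomputable def contValue (Z : (t : ℕ) → (Fin (t + 1) → K) → (Fin t → A × B) → ℝ) (t : ℕ)
    (k : Fin (t + 1) → K) (h : Fin t → A × B) (m : M) : ℝ :=
  ∑ k', ∑ n, d.P (d.e (m, n)) (k (Fin.last t)) k' *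
    Z (t + 1) (Fin.snoc (α := fun _ => K) k k') (Fin.snoc (α := fun _ => A × B) h (d.e (m, n)))

variable {d}

/-- Let `V t` be the `Z`-value at stage `t` averaged with the weights of `x`. The flow equations
turn the averaged continuation value at `t` into `V (t + 1)`, and the sum telescopes. `Z` is
arbitrary apart from its terminal value, so this gives both weak duality and complementary
slackness. -/
theorem pay_eq {n : ℕ} {p : K → ℝ} {x : Plan K A B M} (hx : IsPlan n d.P d.act₁ p x)
    (y : Plan L A B N) (Z : (t : ℕ) → (Fin (t + 1) → K) → (Fin t → A × B) → ℝ)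
    (hZ : ∀ k h, Z n k h = 0) :
    d.pay n x y = ∑ k, p k * Z 0 (fun _ => k) Fin.elim0 - ∑ t ∈ range n, ∑ k, ∑ h, ∑ m,
      x t k h m * (Z t k h - d.stageReward y t k h m - d.contValue Z t k h m) := by
  set V : ℕ → ℝ := fun t => ∑ k, ∑ h, (∑ m, x t k h m) * Z t k h with hV
  have hstep : ∀ t < n, ∑ k, ∑ h, ∑ m, x t k h m * d.contValue Z t k h m = V (t + 1) := by
    intro t ht
    -- At the last stage no flow equation is available, but both sides vanish because `Z n` does.
    rcases (Nat.succ_le_of_lt ht).eq_or_lt with rfl | ht'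
    · simp [hV, contValue, hZ]
    · simp only [hV]
      refine Eq.trans ?_ (sum_snoc_tuple _).symm
      refine sum_congr rfl fun k _ => ?_
      simp only [hx.flow t ht', contValue, sum_snoc_tuple (S := A × B)]
      refine Eq.trans ?_ sum_comm
      refine sum_congr rfl fun h _ => ?_
      refine Eq.trans ?_ sum_comm
      rw [d.sum_pairs]
      simp only [act₁_e, mul_sum]
      refine sum_congr rfl fun m _ => ?_
      rw [sum_comm]
      refine sum_congr rfl fun n _ => sum_congr rfl fun k' _ => ?_
      ring
  have h0 : ∑ k, p k * Z 0 (fun _ => k) Fin.elim0 = V 0 - V n := by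
    have hn : V n = 0 := by simp [hV, hZ]
    rcases Nat.eq_zero_or_pos n with rfl | hn'
    · simp [hZ]
    · rw [hn, sub_zero]
      refine Eq.symm ((sum_tuple_one _).trans (sum_congr rfl fun k _ => ?_))
      rw [sum_tuple_zero, hx.init hn']
  rw [h0, ← sum_range_sub', pay, ← sum_sub_distrib]
  refine sum_congr rfl fun t ht => ?_
  rw [← hstep t (mem_range.1 ht)]
  simp only [hV, sum_mul, mul_sub, sum_sub_distrib]
  ring

/-- A solution of the Bellman inequalities bounds the payoff. -/
theorem pay_le {n : ℕ} {p : K → ℝ} {x : Plan K A B M} (hx : IsPlan n d.P d.act₁ p x)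
    {y : Plan L A B N} {Z : (t : ℕ) → (Fin (t + 1) → K) → (Fin t → A × B) → ℝ}
    (hZ : ∀ k h, Z n k h = 0)
    (hs : ∀ t < n, ∀ k h m, d.stageReward y t k h m + d.contValue Z t k h m ≤ Z t k h) :
    d.pay n x y ≤ ∑ k, p k * Z 0 (fun _ => k) Fin.elim0 := by
  rw [pay_eq hx y Z hZ, sub_le_self_iff]
  exact sum_nonneg fun t ht => sum_nonneg fun k _ => sum_nonneg fun h _ => sum_nonneg fun m _ =>
    mul_nonneg (hx.nonneg t (mem_range.1 ht) _ _ _)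
      (by linarith [hs t (mem_range.1 ht) k h m])

omit [Fintype A] [Fintype B] [Fintype M] [Fintype N] in
theorem P_nonneg (c : A × B) (k k' : K) : 0 ≤ d.P c k k' := (d.P_mem c k).1 k'

omit [Fintype A] [Fintype B] [Fintype M] [Fintype N] in
theorem Q_nonneg (c : A × B) (l l' : L) : 0 ≤ d.Q c l l' := (d.Q_mem c l).1 l'

variable (d) in
/-- The values of the information sets of the maximizer against the plan `y`, when `j` stages
remain. -/
noncomputable def replyValue [Nonempty M] (y : Plan L A B N) :
    ℕ → (t : ℕ) → (Fin (t + 1) → K) → (Fin t → A × B) → ℝ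
  | 0, _, _, _ => 0
  | j + 1, t, k, h => univ.sup' univ_nonempty fun m =>
      d.stageReward y t k h m + d.contValue (replyValue y j) t k h m

/-- The maximizer has a best reply that is optimal at all information sets. -/
theorem exists_bestReply [Nonempty M] (n : ℕ) (y : Plan L A B N) :
    ∃ (Z : (t : ℕ) → (Fin (t + 1) → K) → (Fin t → A × B) → ℝ) (σ : BehaviorStrategy K A B M),
      (∀ k h, Z n k h = 0) ∧
      (∀ t < n, ∀ k h m, d.stageReward y t k h m + d.contValue Z t k h m ≤ Z t k h) ∧
      ∀ p : K → ℝ, (∀ k, 0 ≤ p k) →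
        d.pay n (realization d.P d.act₁ p σ) y = ∑ k, p k * Z 0 (fun _ => k) Fin.elim0 := by
  classical
  -- Backward induction: `replyValue` recurses on the number of remaining stages, which is `n - t`
  -- at stage `t`.
  set Z : (t : ℕ) → (Fin (t + 1) → K) → (Fin t → A × B) → ℝ :=
    fun t => d.replyValue y (n - t) t with hZ
  have hZs (t : ℕ) (ht : t < n) (k h) : Z t k h = univ.sup' univ_nonempty fun m =>
      d.stageReward y t k h m + d.contValue Z t k h m := by
    have e1 : n - t = n - (t + 1) + 1 := by omega
    simp only [hZ, e1, replyValue]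
    rfl
  have hmax (t : ℕ) (k : Fin (t + 1) → K) (h : Fin t → A × B) :
      ∃ m, t < n → Z t k h = d.stageReward y t k h m + d.contValue Z t k h m := by
    by_cases ht : t < n
    · obtain ⟨m, -, hm⟩ := exists_mem_eq_sup' univ_nonempty fun m =>
        d.stageReward y t k h m + d.contValue Z t k h m
      exact ⟨m, fun _ => (hZs t ht k h).trans hm⟩
    · exact ⟨Classical.arbitrary M, fun h => absurd h ht⟩
  choose f hf using hmax
  have hn : ∀ k h, Z n k h = 0 := by simp [hZ, replyValue]
  refine ⟨Z, fun t k h => ⟨Pi.single (f t k h) 1, single_mem_stdSimplex ℝ _⟩, hn, ?_, ?_⟩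
  · intro t ht k h m
    rw [hZs t ht]
    exact le_sup' (fun m => d.stageReward y t k h m + d.contValue Z t k h m) (mem_univ m)
  · intro p hp
    -- The reply puts all its weight on actions without slack, whatever the initial law is. Hence
    -- one `σ` serves all `p`, including unnormalized ones.
    rw [pay_eq (isPlan_realization _ _ _ _ n P_nonneg hp) y Z hn, sub_eq_self]
    refine sum_eq_zero fun t ht => sum_eq_zero fun k _ => sum_eq_zero fun h _ =>
      sum_eq_zero fun m _ => ?_
    by_cases hm : m = f t k h
    · rw [hm, hf t k h (mem_range.1 ht)]
      ring
    · simp [realization, hm]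

/-- After the first stage the rewards depend on neither initial state, so the two sums over initial
states factor into the two shifted plans. Each later stage gives up one factor `lam`. -/
theorem pay_succ (n : ℕ) (x : Plan K A B M) (y : Plan L A B N) :
    d.pay (n + 1) x y =
      ∑ k, ∑ m, x 0 (fun _ => k) Fin.elim0 m *
        (∑ l, ∑ n', y 0 (fun _ => l) Fin.elim0 n' * d.G k l (d.e (m, n'))) +
      d.lam * ∑ m, ∑ n', d.pay n (x.shift (d.e (m, n'))) (y.shift (d.e (m, n'))) := by
  rw [pay, sum_range_succ', add_comm]
  congr 1
  · refine (sum_tuple_one _).trans (sum_congr rfl fun k _ => ?_)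
    rw [sum_tuple_zero]
    refine sum_congr rfl fun m _ => congrArg _ ((sum_tuple_one _).trans ?_)
    simp
  · rw [← d.sum_pairs fun c => d.pay n (x.shift c) (y.shift c)]
    simp only [pay]
    rw [sum_comm, mul_sum]
    refine sum_congr rfl fun t _ => ?_
    rw [sum_cons_tuple, sum_comm]
    simp only [sum_cons_tuple (S := A × B)]
    have hr (k₀ : K) (k : Fin (t + 1) → K) (c : A × B) (h : Fin t → A × B) (m : M) :
        d.stageReward y (t + 1) (Fin.cons (α := fun _ => K) k₀ k)
          (Fin.cons (α := fun _ => A × B) c h) m =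
        d.lam * d.stageReward (y.shift c) t k h m := by
      simp only [stageReward, Plan.shift]
      rw [sum_cons_tuple, sum_comm, mul_sum]
      refine sum_congr rfl fun l _ => ?_
      rw [sum_comm, mul_sum]
      refine sum_congr rfl fun n' _ => ?_
      simp only [sum_mul, mul_sum]
      refine sum_congr rfl fun l₀ _ => ?_
      have e1 : (Fin.cons k₀ k : Fin (t + 1 + 1) → K) (Fin.last (t + 1)) = k (Fin.last t) := rfl
      have e2 : (Fin.cons l₀ l : Fin (t + 1 + 1) → L) (Fin.last (t + 1)) = l (Fin.last t) := rfl
      rw [e1, e2]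
      ring
    simp only [hr]
    rw [mul_sum]
    simp only [mul_sum]
    have : ∀ k : Fin (t + 1) → K, ∑ k₀, ∑ c, ∑ h : Fin t → A × B, ∑ m,
        x (t + 1) (Fin.cons (α := fun _ => K) k₀ k) (Fin.cons (α := fun _ => A × B) c h) m *
          (d.lam * d.stageReward (y.shift c) t k h m) =
        ∑ c, ∑ h : Fin t → A × B, ∑ m,
          d.lam * (x.shift c t k h m * d.stageReward (y.shift c) t k h m) := by
      intro k
      rw [sum_comm]
      refine sum_congr rfl fun c _ => ?_
      rw [sum_comm]
      refine sum_congr rfl fun h _ => ?_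
      rw [sum_comm]
      refine sum_congr rfl fun m _ => ?_
      simp only [Plan.shift, sum_mul, mul_sum]
      exact sum_congr rfl fun k₀ _ => by ring
    simp only [this]
    exact sum_comm

variable (d)

theorem pay_congr {n : ℕ} {x x' : Plan K A B M} {y y' : Plan L A B N} (hx : ∀ t < n, x t = x' t)
    (hy : ∀ t < n, y t = y' t) : d.pay n x y = d.pay n x' y' := by
  refine sum_congr rfl fun t ht => ?_
  simp only [stageReward, hx t (mem_range.1 ht), hy t (mem_range.1 ht)]

theorem pay_smul_right (n : ℕ) (x : Plan K A B M) (y : Plan L A B N) (s : ℝ) :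
    d.pay n x (s • y) = s * d.pay n x y := by
  simp only [pay, stageReward, mul_sum, Pi.smul_apply, smul_eq_mul]
  refine sum_congr rfl fun t _ => sum_congr rfl fun k _ => sum_congr rfl fun h _ =>
    sum_congr rfl fun m _ => sum_congr rfl fun l _ => sum_congr rfl fun n' _ => ?_
  ring

theorem pay_add_right (n : ℕ) (x : Plan K A B M) (y y' : Plan L A B N) :
    d.pay n x (y + y') = d.pay n x y + d.pay n x y' := by
  simp only [pay, stageReward, ← sum_add_distrib, ← mul_add]
  simp [add_mul]

theorem pay_smul_left (n : ℕ) (x : Plan K A B M) (y : Plan L A B N) (s : ℝ) :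
    d.pay n (s • x) y = s * d.pay n x y := by
  simp [pay, mul_sum, mul_assoc]

theorem pay_add_left (n : ℕ) (x x' : Plan K A B M) (y : Plan L A B N) :
    d.pay n (x + x') y = d.pay n x y + d.pay n x' y := by
  simp [pay, add_mul, sum_add_distrib]

end PlanGame

/-! ### Saddle points -/

section Saddle

variable {X Y : Type*} {f : X → Y → ℝ} {x₀ : X} {y₀ : Y}

theorem isGameValue_of_saddle (h : ∀ x y, f x y₀ ≤ f x₀ y) : IsGameValue f (f x₀ y₀) := by
  refine ⟨⟨⟨x₀, ⟨y₀, rfl⟩, ?_⟩, ?_⟩, ⟨y₀, ⟨x₀, rfl⟩, ?_⟩, ?_⟩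
  · rintro _ ⟨y, rfl⟩
    exact h x₀ y
  · rintro r ⟨x, -, hr⟩
    exact (hr ⟨y₀, rfl⟩).trans (h x y₀)
  · rintro _ ⟨x, rfl⟩
    exact h x y₀
  · rintro r ⟨y, -, hr⟩
    exact (h x₀ y).trans (hr ⟨x₀, rfl⟩)

/-- Boundedness is needed because a real supremum over an unbounded set takes the default value `0`,
which could spoil the infimum. -/
theorem gameValue_of_saddle (h : ∀ x y, f x y₀ ≤ f x₀ y)
    (hb : ∀ y, BddAbove (Set.range fun x => f x y)) : gameValue f = f x₀ y₀ := by
  have : Nonempty X := ⟨x₀⟩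
  have : Nonempty Y := ⟨y₀⟩
  have hle (y : Y) : f x₀ y₀ ≤ ⨆ x, f x y := (h x₀ y).trans (le_ciSup (hb y) x₀)
  refine le_antisymm ((ciInf_le ⟨f x₀ y₀, ?_⟩ y₀).trans (ciSup_le fun x => h x y₀)) (le_ciInf hle)
  rintro _ ⟨y, rfl⟩
  exact hle y

end Saddle

/-! ### Compactness of the sets of plans -/

section Compact

open BehaviorStrategy

variable {S A B M : Type*}

/-- The plan `y` up to stage `n`. -/
def Plan.truncate (n : ℕ) (y : Plan S A B M) : Plan S A B M :=
  fun t => if t < n then y t else 0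

theorem Plan.truncate_of_lt {n t : ℕ} (y : Plan S A B M) (h : t < n) : y.truncate n t = y t :=
  if_pos h

variable [Fintype M]

theorem IsPlan.congr {n : ℕ} {T : A × B → S → S → ℝ} {π : A × B → M} {r : S → ℝ}
    {y y' : Plan S A B M} (hy : IsPlan n T π r y) (h : ∀ t < n, y t = y' t) :
    IsPlan n T π r y' where
  nonneg t ht := by rw [← h t ht]; exact hy.nonneg t ht
  init hn := by rw [← h 0 hn]; exact hy.init hn
  flow t ht := by rw [← h t (by omega), ← h (t + 1) ht]; exact hy.flow t ht

theorem IsPlan.combo {n : ℕ} {T : A × B → S → S → ℝ} {π : A × B → M} {r r' : S → ℝ}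
    {y y' : Plan S A B M} (hy : IsPlan n T π r y) (hy' : IsPlan n T π r' y') {u v : ℝ}
    (hu : 0 ≤ u) (hv : 0 ≤ v) : IsPlan n T π (u • r + v • r') (u • y + v • y') where
  nonneg t ht s h m := add_nonneg (mul_nonneg hu (hy.nonneg t ht s h m))
    (mul_nonneg hv (hy'.nonneg t ht s h m))
  init hn s := by
    simp [sum_add_distrib, ← mul_sum, hy.init hn, hy'.init hn]
  flow t ht s h c s' := by
    simp only [Pi.add_apply, Pi.smul_apply, smul_eq_mul, sum_add_distrib, ← mul_sum,
      hy.flow t ht, hy'.flow t ht]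
    ring

theorem continuous_realization (T : A × B → S → S → ℝ) (π : A × B → M) :
    Continuous fun z : (S → ℝ) × BehaviorStrategy S A B M => realization T π z.1 z.2 := by
  refine continuous_pi fun t => continuous_pi fun s => continuous_pi fun h =>
    continuous_pi fun m => ?_
  have hτ (t : ℕ) (s : Fin (t + 1) → S) (h : Fin t → A × B) (m : M) :
      Continuous fun z : (S → ℝ) × BehaviorStrategy S A B M => (z.2 t s h).1 m :=
    (continuous_apply m).comp (continuous_subtype_val.comp ((continuous_apply h).comp
      ((continuous_apply s).comp ((continuous_apply t).comp continuous_snd))))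
  refine Continuous.mul (Continuous.mul ((continuous_apply _).comp continuous_fst) ?_) (hτ _ _ _ _)
  exact continuous_finsetProd _ fun i _ => (hτ _ _ _ _).mul continuous_const

variable (n : ℕ) (T : A × B → S → S → ℝ) (π : A × B → M) (R : Set (S → ℝ))

/-- The truncated realization plans whose initial law is in `R`. -/
def planSet : Set (Plan S A B M) :=
  {y | (∃ r ∈ R, IsPlan n T π r y) ∧ ∀ t, n ≤ t → y t = 0}

variable {n T π R}

theorem convex_planSet (hR : Convex ℝ R) : Convex ℝ (planSet n T π R) := by
  rintro y ⟨⟨r, hr, hy⟩, h0⟩ y' ⟨⟨r', hr', hy'⟩, h0'⟩ u v hu hv huv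
  exact ⟨⟨_, hR hr hr' hu hv huv, hy.combo hy' hu hv⟩, fun _ ht => by simp [h0 _ ht, h0' _ ht]⟩

theorem truncate_realization_mem_planSet (hT : ∀ c s s', 0 ≤ T c s s') {r : S → ℝ} (hr : r ∈ R)
    (hr₀ : ∀ s, 0 ≤ r s) (τ : BehaviorStrategy S A B M) :
    (realization T π r τ).truncate n ∈ planSet n T π R :=
  ⟨⟨r, hr, (isPlan_realization T π r τ n hT hr₀).congr
    fun _ ht => (Plan.truncate_of_lt _ ht).symm⟩, fun _ ht => if_neg ht.not_gt⟩

theorem exists_of_mem_planSet [Nonempty M] {y : Plan S A B M} (hy : y ∈ planSet n T π R) :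
    ∃ r ∈ R, ∃ τ : BehaviorStrategy S A B M, (realization T π r τ).truncate n = y := by
  obtain ⟨⟨r, hr, h⟩, h0⟩ := hy
  obtain ⟨τ, hτ⟩ := h.exists_realization
  refine ⟨r, hr, τ, funext fun t => ?_⟩
  by_cases ht : t < n
  · rw [Plan.truncate_of_lt _ ht, hτ t ht]
  · rw [Plan.truncate, if_neg ht, h0 t (not_lt.1 ht)]

/-- The set is the continuous image of `R` times the space of behavioral strategies, and that space
is a product of simplices, hence compact. -/
theorem isCompact_planSet [Nonempty M] (hT : ∀ c s s', 0 ≤ T c s s') (hR : IsCompact R)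
    (hR₀ : ∀ r ∈ R, ∀ s, 0 ≤ r s) : IsCompact (planSet n T π R) := by
  have e : planSet n T π R = (fun z : (S → ℝ) × BehaviorStrategy S A B M =>
      (realization T π z.1 z.2).truncate n) '' (R ×ˢ Set.univ) := by
    ext y
    constructor
    · intro hy
      obtain ⟨r, hr, τ, h⟩ := exists_of_mem_planSet hy
      exact ⟨(r, τ), ⟨hr, trivial⟩, h⟩
    · rintro ⟨⟨r, τ⟩, ⟨hr, -⟩, rfl⟩
      exact truncate_realization_mem_planSet hT hr (hR₀ r hr) τ
  rw [e]
  refine (hR.prod isCompact_univ).image (continuous_pi fun t => ?_)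
  by_cases ht : t < n
  · simp only [Plan.truncate, if_pos ht]
    exact (continuous_apply t).comp (continuous_realization T π)
  · simp only [Plan.truncate, if_neg ht]
    exact continuous_const

end Compact

/-! ### Existence of the value -/

namespace PlanGame

open BehaviorStrategy

variable {K L A B M N : Type*} [Fintype K] [Fintype L] [Fintype A] [Fintype B] [Fintype M]
  [Fintype N] (d : PlanGame K L A B M N)

/-- The payoff of the dual game in which the maximizer chooses its initial law and is paid `μ` at
its initial state, and `r` is the initial law of the minimizer. -/
noncomputable def payoff (n : ℕ) (μ : K → ℝ) (r : L → ℝ)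
    (x : stdSimplex ℝ K × BehaviorStrategy K A B M) (τ : BehaviorStrategy L A B N) : ℝ :=
  ∑ k, x.1.1 k * μ k +
    d.pay n (realization d.P d.act₁ x.1.1 x.2) (realization d.Q d.act₂ r τ)

/-- The payoff of the dual game in terms of plans. -/
noncomputable def planPayoff (n : ℕ) (μ : K → ℝ) (y : Plan L A B N) (x : Plan K A B M) : ℝ :=
  ∑ k, (∑ m, x 0 (fun _ => k) Fin.elim0 m) * μ k + d.pay n x y

/-- Truncating at `n + 1` instead of `n` keeps stage `0` even in the game without stages, so that
the plan still determines the law that `μ` is paired with. -/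
theorem payoff_eq_planPayoff (n : ℕ) (μ : K → ℝ) (r : L → ℝ)
    (x : stdSimplex ℝ K × BehaviorStrategy K A B M) (τ : BehaviorStrategy L A B N) :
    d.payoff n μ r x τ = d.planPayoff n μ ((realization d.Q d.act₂ r τ).truncate (n + 1))
      ((realization d.P d.act₁ x.1.1 x.2).truncate (n + 1)) := by
  rw [payoff, planPayoff]
  congr 1
  · simp only [Plan.truncate_of_lt _ n.succ_pos, sum_realization, reach_zero]
  · exact d.pay_congr (fun t ht => (Plan.truncate_of_lt _ (by omega)).symm)
      fun t ht => (Plan.truncate_of_lt _ (by omega)).symm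

theorem continuous_planPayoff (n : ℕ) (μ : K → ℝ) :
    Continuous fun z : Plan L A B N × Plan K A B M => d.planPayoff n μ z.1 z.2 := by
  have hx (t : ℕ) (s : Fin (t + 1) → K) (h : Fin t → A × B) (m : M) :
      Continuous fun z : Plan L A B N × Plan K A B M => z.2 t s h m :=
    (continuous_apply m).comp ((continuous_apply h).comp
      ((continuous_apply s).comp ((continuous_apply t).comp continuous_snd)))
  have hy (t : ℕ) (s : Fin (t + 1) → L) (h : Fin t → A × B) (m : N) :
      Continuous fun z : Plan L A B N × Plan K A B M => z.1 t s h m :=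
    (continuous_apply m).comp ((continuous_apply h).comp
      ((continuous_apply s).comp ((continuous_apply t).comp continuous_fst)))
  refine Continuous.add (continuous_finsetSum _ fun k _ =>
    (continuous_finsetSum _ fun m _ => hx _ _ _ _).mul continuous_const) ?_
  exact continuous_finsetSum _ fun t _ => continuous_finsetSum _ fun k _ =>
    continuous_finsetSum _ fun h _ => continuous_finsetSum _ fun m _ => (hx _ _ _ _).mul
      (continuous_finsetSum _ fun l _ => continuous_finsetSum _ fun n' _ =>
        ((hy _ _ _ _).mul continuous_const).mul continuous_const)

/-- The `μ` term is constant in `y`, so the payoff is only affine in the minimizer's plan, and the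
weights must sum to one. -/
theorem planPayoff_combo_left (n : ℕ) (μ : K → ℝ) (y y' : Plan L A B N) (x : Plan K A B M)
    {u v : ℝ} (huv : u + v = 1) : d.planPayoff n μ (u • y + v • y') x =
      u * d.planPayoff n μ y x + v * d.planPayoff n μ y' x := by
  simp only [planPayoff, pay_add_right, pay_smul_right]
  linear_combination (-∑ k, (∑ m, x 0 (fun _ => k) Fin.elim0 m) * μ k) * huv

theorem planPayoff_combo_right (n : ℕ) (μ : K → ℝ) (y : Plan L A B N) (x x' : Plan K A B M)
    (u v : ℝ) : d.planPayoff n μ y (u • x + v • x') =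
      u * d.planPayoff n μ y x + v * d.planPayoff n μ y x' := by
  simp only [planPayoff, pay_add_left, pay_smul_left, Pi.add_apply, Pi.smul_apply, smul_eq_mul,
    sum_add_distrib, ← mul_sum, add_mul, mul_assoc]
  ring

variable [Nonempty K] [Nonempty M] [Nonempty N]

theorem exists_saddle (n : ℕ) (μ : K → ℝ) {r : L → ℝ} (hr : ∀ l, 0 ≤ r l) :
    ∃ x₀ τ₀, ∀ x τ, d.payoff n μ r x τ₀ ≤ d.payoff n μ r x₀ τ := by
  have nN (S : Type _) (C : Type _) [Fintype C] [Nonempty C] :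
      Nonempty (BehaviorStrategy S A B C) := by
    obtain ⟨x, -⟩ := exists_mem_stdSimplex_smul (fun _ : C => (0 : ℝ)) fun _ => le_rfl
    exact ⟨fun _ _ _ => x⟩
  obtain ⟨τ₁⟩ : Nonempty (BehaviorStrategy L A B N) := inferInstance
  obtain ⟨σ₁⟩ : Nonempty (BehaviorStrategy K A B M) := inferInstance
  obtain ⟨p₁, -⟩ := exists_mem_stdSimplex_smul (fun _ : K => (0 : ℝ)) fun _ => le_rfl
  have memX (τ) : (realization d.Q d.act₂ r τ).truncate (n + 1) ∈
      planSet (n + 1) d.Q d.act₂ {r} :=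
    truncate_realization_mem_planSet Q_nonneg (Set.mem_singleton r) hr τ
  have memY (x : stdSimplex ℝ K × BehaviorStrategy K A B M) :
      (realization d.P d.act₁ x.1.1 x.2).truncate (n + 1) ∈
      planSet (n + 1) d.P d.act₁ (stdSimplex ℝ K) :=
    truncate_realization_mem_planSet P_nonneg x.1.2 x.1.2.1 x.2
  have cX : Convex ℝ (planSet (n + 1) d.Q d.act₂ {r}) := convex_planSet (convex_singleton r)
  have cY : Convex ℝ (planSet (n + 1) d.P d.act₁ (stdSimplex ℝ K)) :=
    convex_planSet (convex_stdSimplex ℝ K)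
  -- The minimizer's law is fixed, which gives the singleton `{r}`; the maximizer's law ranges over
  -- the whole simplex.
  obtain ⟨y, hy, x, hx, h⟩ := Sion.exists_isSaddlePointOn (f := d.planPayoff n μ)
    (X := planSet (n + 1) d.Q d.act₂ {r}) (Y := planSet (n + 1) d.P d.act₁ (stdSimplex ℝ K))
    ⟨_, memX τ₁⟩ cX
    (isCompact_planSet Q_nonneg isCompact_singleton (by rintro _ rfl; exact hr))
    (fun x _ => ((d.continuous_planPayoff n μ).comp
      (Continuous.prodMk_left x)).lowerSemicontinuous.lowerSemicontinuousOn _)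
    (fun x _ => ConvexOn.quasiconvexOn ⟨cX, fun y _ y' _ u v _ _ huv =>
      (d.planPayoff_combo_left n μ y y' x huv).le⟩)
    cY ⟨_, memY (p₁, σ₁)⟩
    (isCompact_planSet P_nonneg (isCompact_stdSimplex ℝ K) fun p hp => hp.1)
    (fun y _ => ((d.continuous_planPayoff n μ).comp
      (Continuous.prodMk_right y)).upperSemicontinuous.upperSemicontinuousOn _)
    (fun y _ => ConcaveOn.quasiconcaveOn ⟨cY, fun x _ x' _ u v _ _ _ =>
      (d.planPayoff_combo_right n μ y x x' u v).ge⟩)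
  obtain ⟨_, rfl, τ₀, rfl⟩ := exists_of_mem_planSet hy
  obtain ⟨p₀, hp₀, σ₀, rfl⟩ := exists_of_mem_planSet hx
  refine ⟨(⟨p₀, hp₀⟩, σ₀), τ₀, fun x τ => ?_⟩
  rw [payoff_eq_planPayoff, payoff_eq_planPayoff]
  exact h _ (memX τ) _ (memY x)

omit [Nonempty K] in
theorem exists_payoff_bound (n : ℕ) (μ : K → ℝ) {r : L → ℝ} (hr : ∀ l, 0 ≤ r l) :
    ∃ C, ∀ x τ, |d.payoff n μ r x τ| ≤ C := by
  obtain ⟨C, hC⟩ := ((isCompact_planSet (n := n + 1) (π := d.act₂) d.Q_nonneg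
    (isCompact_singleton (x := r)) (by rintro _ rfl; exact hr)).prod
    (isCompact_planSet (n := n + 1) (π := d.act₁) d.P_nonneg (isCompact_stdSimplex ℝ K)
      fun p hp => hp.1)).exists_bound_of_continuousOn
    (d.continuous_planPayoff n μ).continuousOn
  refine ⟨C, fun x τ => ?_⟩
  rw [payoff_eq_planPayoff]
  exact hC (_, _) ⟨truncate_realization_mem_planSet d.Q_nonneg (Set.mem_singleton r) hr τ,
    truncate_realization_mem_planSet d.P_nonneg x.1.2 x.1.2.1 x.2⟩

/-- The value of the dual game. -/
noncomputable def value (n : ℕ) (μ : K → ℝ) (r : L → ℝ) : ℝ := gameValue (d.payoff n μ r)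

theorem exists_saddle_value (n : ℕ) (μ : K → ℝ) {r : L → ℝ} (hr : ∀ l, 0 ≤ r l) :
    ∃ x₀ τ₀, (∀ x τ, d.payoff n μ r x τ₀ ≤ d.payoff n μ r x₀ τ) ∧
      d.value n μ r = d.payoff n μ r x₀ τ₀ := by
  obtain ⟨x₀, τ₀, h⟩ := d.exists_saddle n μ hr
  obtain ⟨C, hC⟩ := d.exists_payoff_bound n μ hr
  refine ⟨x₀, τ₀, h, gameValue_of_saddle h fun τ => ⟨C, ?_⟩⟩
  rintro _ ⟨x, rfl⟩
  exact (abs_le.1 (hC x τ)).2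

theorem isGameValue_payoff (n : ℕ) (μ : K → ℝ) {r : L → ℝ} (hr : ∀ l, 0 ≤ r l) :
    IsGameValue (d.payoff n μ r) (d.value n μ r) := by
  obtain ⟨x₀, τ₀, h, hw⟩ := d.exists_saddle_value n μ hr
  rw [hw]
  exact isGameValue_of_saddle h

theorem gameValue_neg_payoff (n : ℕ) (μ : K → ℝ) {r : L → ℝ} (hr : ∀ l, 0 ≤ r l) :
    gameValue (fun τ x => -d.payoff n μ r x τ) = -d.value n μ r := by
  obtain ⟨x₀, τ₀, h, hw⟩ := d.exists_saddle_value n μ hr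
  obtain ⟨C, hC⟩ := d.exists_payoff_bound n μ hr
  rw [hw]
  refine gameValue_of_saddle (f := fun τ x => -d.payoff n μ r x τ)
    (fun τ x => neg_le_neg (h x τ)) fun x => ⟨C, ?_⟩
  rintro _ ⟨τ, rfl⟩
  exact neg_le.1 (abs_le.1 (hC x τ)).1

theorem isGameValue_neg_payoff (n : ℕ) (μ : K → ℝ) {r : L → ℝ} (hr : ∀ l, 0 ≤ r l) :
    IsGameValue (fun τ x => -d.payoff n μ r x τ) (-d.value n μ r) := by
  obtain ⟨x₀, τ₀, h, hw⟩ := d.exists_saddle_value n μ hr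
  rw [hw]
  exact isGameValue_of_saddle (f := fun τ x => -d.payoff n μ r x τ)
    fun τ x => neg_le_neg (h x τ)

/-- A strategy that guarantees a level bounds the value. -/
theorem value_le {n : ℕ} {μ : K → ℝ} {r : L → ℝ} (hr : ∀ l, 0 ≤ r l)
    {τ : BehaviorStrategy L A B N} {v : ℝ} (h : ∀ x, d.payoff n μ r x τ ≤ v) :
    d.value n μ r ≤ v := by
  obtain ⟨x₀, τ₀, hs, hw⟩ := d.exists_saddle_value n μ hr
  rw [hw]
  exact (hs x₀ τ).trans (h x₀)

theorem exists_le_value (n : ℕ) (μ : K → ℝ) {r : L → ℝ} (hr : ∀ l, 0 ≤ r l) :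
    ∃ τ, ∀ x, d.payoff n μ r x τ ≤ d.value n μ r := by
  obtain ⟨x₀, τ₀, hs, hw⟩ := d.exists_saddle_value n μ hr
  exact ⟨τ₀, fun x => hw ▸ hs x τ₀⟩

end PlanGame

/-! ### Linear programs for the first stage -/

section Belief

variable {S C : Type*} [Fintype S] [Fintype C] {T : S → S → ℝ} {r : S → ℝ}
  {Y : S → stdSimplex ℝ C} {c : C} {r₀ : S → ℝ}

theorem actProb_nonneg (hr : ∀ s, 0 ≤ r s) : 0 ≤ actProb r Y c :=
  sum_nonneg fun s _ => mul_nonneg (hr s) ((Y s).2.1 c)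

theorem mul_eq_zero_of_actProb (hr : ∀ s, 0 ≤ r s) (h : actProb r Y c = 0) (s : S) :
    r s * (Y s).1 c = 0 :=
  (sum_eq_zero_iff_of_nonneg fun s _ => mul_nonneg (hr s) ((Y s).2.1 c)).1 h s (mem_univ s)

theorem nextBelief_nonneg (hT : ∀ s s', 0 ≤ T s s') (hr : ∀ s, 0 ≤ r s) (hr₀ : ∀ s, 0 ≤ r₀ s)
    (s' : S) : 0 ≤ nextBelief T r Y c r₀ s' := by
  rw [nextBelief]
  split_ifs
  · exact hr₀ s'
  · exact sum_nonneg fun s _ => mul_nonneg (hT s s')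
      (div_nonneg (mul_nonneg (hr s) ((Y s).2.1 c)) (actProb_nonneg hr))

/-- After an action of probability zero both sides vanish. So the prescribed belief `r₀` has no
effect once it is weighted by `actProb`. -/
theorem actProb_mul_nextBelief (hr : ∀ s, 0 ≤ r s) (s' : S) :
    actProb r Y c * nextBelief T r Y c r₀ s' = ∑ s, r s * (Y s).1 c * T s s' := by
  by_cases h : actProb r Y c = 0
  · rw [h, zero_mul]
    exact (sum_eq_zero fun s _ => by rw [mul_eq_zero_of_actProb hr h, zero_mul]).symm
  · rw [nextBelief, if_neg h, mul_sum]
    exact sum_congr rfl fun s _ => by field_simp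

end Belief

theorem IsPlan.smul {S A B M : Type*} [Fintype M] {n : ℕ} {T : A × B → S → S → ℝ} {π : A × B → M}
    {r : S → ℝ} {y : Plan S A B M} (hy : IsPlan n T π r y) {u : ℝ} (hu : 0 ≤ u) :
    IsPlan n T π (u • r) (u • y) := by
  simpa using hy.combo hy hu le_rfl

section Linear

variable {A K : Type*} [Fintype A] [Fintype K] (F : A → K → ℝ)

theorem exists_vertex (a : A) (k : K) :
    ∃ Pi : stdSimplex ℝ (A × K), ∑ a', ∑ k', Pi.1 (a', k') * F a' k' = F a k := by
  classical
  refine ⟨⟨Pi.single (a, k) 1, single_mem_stdSimplex ℝ _⟩, ?_⟩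
  rw [← Fintype.sum_prod_type'
      (f := fun a' k' => (Pi.single (a, k) 1 : A × K → ℝ) (a', k') * F a' k'),
    sum_eq_single (a, k)] <;> simp +contextual

/-- A linear function on the simplex attains its maximum at a vertex. -/
theorem exists_isGreatest_linear [Nonempty A] [Nonempty K] : ∃ a k, IsGreatest
    (Set.range fun Pi : stdSimplex ℝ (A × K) => ∑ a, ∑ k, Pi.1 (a, k) * F a k) (F a k) := by
  obtain ⟨⟨a₀, k₀⟩, h⟩ := Finite.exists_max fun z : A × K => F z.1 z.2
  refine ⟨a₀, k₀, exists_vertex F a₀ k₀, ?_⟩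
  rintro _ ⟨Pi, rfl⟩
  calc ∑ a, ∑ k, Pi.1 (a, k) * F a k ≤ ∑ a, ∑ k, Pi.1 (a, k) * F a₀ k₀ :=
        sum_le_sum fun a _ => sum_le_sum fun k _ =>
          mul_le_mul_of_nonneg_left (h (a, k)) (Pi.2.1 _)
    _ = F a₀ k₀ := by
        rw [← Fintype.sum_prod_type' (f := fun a k => Pi.1 (a, k) * F a₀ k₀), ← sum_mul, Pi.2.2,
          one_mul]

end Linear

namespace PlanGame

open BehaviorStrategy

variable {K L A B M N : Type*} [Fintype K] [Fintype L] [Fintype A] [Fintype B] [Fintype M]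
  [Fintype N] (d : PlanGame K L A B M N)

/-- The constraints of the linear program for one pair of first stage actions, with `m` remaining
stages. -/
structure InnerFeasible (m : ℕ) (r : L → ℝ) (β : K → ℝ) (z₀ : ℝ)
    (Z : (t : ℕ) → (Fin (t + 1) → K) → (Fin t → A × B) → ℝ) (S : Plan L A B N) : Prop where
  initial : ∀ k, β k + Z 0 (fun _ => k) Fin.elim0 ≤ z₀
  step : ∀ t < m, ∀ k h a, d.stageReward S t k h a + d.contValue Z t k h a ≤ Z t k h
  flow : ∀ t, t + 1 < m → ∀ l h c l',
    ∑ n, S (t + 1) (Fin.snoc (α := fun _ => L) l l') (Fin.snoc (α := fun _ => A × B) h c) n =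
      d.Q c (l (Fin.last t)) l' * S t l h (d.act₂ c)
  flow_one : ∀ l, ∑ n, S 0 (fun _ => l) Fin.elim0 n = r l
  terminal : ∀ k h, Z m k h = 0
  nonneg : ∀ t < m, ∀ l h n, 0 ≤ S t l h n

variable {d} in
omit [Fintype A] [Fintype B] [Fintype M] in
theorem InnerFeasible.isPlan {m : ℕ} {r : L → ℝ} {β : K → ℝ} {z₀ : ℝ}
    {Z : (t : ℕ) → (Fin (t + 1) → K) → (Fin t → A × B) → ℝ} {S : Plan L A B N}
    (h : d.InnerFeasible m r β z₀ Z S) : IsPlan m d.Q d.act₂ r S :=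
  ⟨h.nonneg, fun _ => h.flow_one, h.flow⟩

variable {d} in
theorem InnerFeasible.pay_le {m : ℕ} {r : L → ℝ} {β : K → ℝ} {z₀ : ℝ}
    {Z : (t : ℕ) → (Fin (t + 1) → K) → (Fin t → A × B) → ℝ} {S : Plan L A B N}
    (h : d.InnerFeasible m r β z₀ Z S) {p : K → ℝ} (hp : ∀ k, 0 ≤ p k) {x : Plan K A B M}
    (hx : IsPlan m d.P d.act₁ p x) : d.pay m x S ≤ ∑ k, p k * (z₀ - β k) :=
  (PlanGame.pay_le hx h.terminal h.step).trans
    (sum_le_sum fun k _ => mul_le_mul_of_nonneg_left (by linarith [h.initial k]) (hp k))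

/-- The coefficient of `Π(a, k)` in the one-stage problem, with continuation values `v`. -/
noncomputable def stageCoeff (μ : K → ℝ) (q : L → ℝ) (Y : L → stdSimplex ℝ N)
    (β : A × B → K → ℝ) (v : A × B → ℝ) (a : M) (k : K) : ℝ :=
  μ k + ∑ l, ∑ b, d.G k l (d.e (a, b)) * (Y l).1 b * q l +
    d.lam * ∑ b, actProb q Y b *
      (v (d.e (a, b)) - ∑ k', d.P (d.e (a, b)) k k' * β (d.e (a, b)) k')

/-- The belief about the state of the minimizer after the first stage. -/
noncomputable def belief (r₀ : A × B → L → ℝ) (q : L → ℝ) (Y : L → stdSimplex ℝ N) (c : A × B) :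
    L → ℝ :=
  nextBelief (d.Q c) q Y (d.act₂ c) (r₀ c)

variable {d} in
omit [Fintype A] [Fintype B] [Fintype M] in
theorem belief_nonneg {r₀ : A × B → L → ℝ} (hr₀ : ∀ c l, 0 ≤ r₀ c l) {q : L → ℝ}
    (hq : ∀ l, 0 ≤ q l) (Y : L → stdSimplex ℝ N) (c : A × B) (l : L) :
    0 ≤ d.belief r₀ q Y c l :=
  nextBelief_nonneg (Q_nonneg c) hq (hr₀ c) l

/-- Feasibility in the linear program, with `m` stages after the first one. -/
structure Feasible (m : ℕ) (r₀ : A × B → L → ℝ) (μ : K → ℝ) (q : L → ℝ) (Y : L → stdSimplex ℝ N)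
    (ρ : ℝ) (β : A × B → K → ℝ) (Z₀ : A × B → ℝ)
    (Z : A × B → (t : ℕ) → (Fin (t + 1) → K) → (Fin t → A × B) → ℝ)
    (S : A × B → Plan L A B N) : Prop where
  objective : ∀ a k, d.stageCoeff μ q Y β Z₀ a k ≤ ρ
  inner : ∀ c, d.InnerFeasible m (d.belief r₀ q Y c) (β c) (Z₀ c) (Z c) (S c)

/-- The objective of the one-stage problem. -/
noncomputable def stageObjective (m : ℕ) (r₀ : A × B → L → ℝ) (μ : K → ℝ) (q : L → ℝ)
    (Y : L → stdSimplex ℝ N) (β : A × B → K → ℝ) (Pi : stdSimplex ℝ (M × K)) : ℝ :=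
  ∑ a, ∑ k, Pi.1 (a, k) *
    d.stageCoeff μ q Y β (fun c => d.value m (β c) (d.belief r₀ q Y c)) a k

theorem payoff_succ (m : ℕ) (μ : K → ℝ) (q : L → ℝ)
    (x : stdSimplex ℝ K × BehaviorStrategy K A B M) (τ : BehaviorStrategy L A B N) :
    d.payoff (m + 1) μ q x τ =
      ∑ k, ∑ a, x.1.1 k * (x.2.first k).1 a *
        (μ k + ∑ l, ∑ b, d.G k l (d.e (a, b)) * (τ.first l).1 b * q l) +
      d.lam * ∑ a, ∑ b, d.pay m ((realization d.P d.act₁ x.1.1 x.2).shift (d.e (a, b)))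
        ((realization d.Q d.act₂ q τ).shift (d.e (a, b))) := by
  rw [payoff, pay_succ, ← add_assoc, ← sum_add_distrib]
  congr 1
  refine sum_congr rfl fun k _ => ?_
  have : x.1.1 k * μ k = ∑ a, x.1.1 k * (x.2.first k).1 a * μ k := by
    rw [← sum_mul, ← mul_sum, (x.2.first k).2.2, mul_one]
  rw [this, ← sum_add_distrib]
  refine sum_congr rfl fun a _ => ?_
  rw [realization_zero, mul_add]
  congr 2
  refine sum_congr rfl fun l _ => sum_congr rfl fun b _ => ?_
  rw [realization_zero]
  ring

omit [Fintype A] [Fintype B] [Fintype M] in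
/-- The plan of a strategy after the first stage is a multiple of a plan from the belief. -/
theorem exists_plan_of_strategy [Nonempty N] (m : ℕ) {r₀ : A × B → L → ℝ}
    (hr₀ : ∀ c l, 0 ≤ r₀ c l) {q : L → ℝ} (hq : ∀ l, 0 ≤ q l) (τ : BehaviorStrategy L A B N)
    (c : A × B) : ∃ S, IsPlan m d.Q d.act₂ (d.belief r₀ q τ.first c) S ∧
      (realization d.Q d.act₂ q τ).shift c = actProb q τ.first (d.act₂ c) • S := by
  by_cases h : actProb q τ.first (d.act₂ c) = 0
  -- After a null action the shifted plan is zero, so any plan from the belief will do; `τ` itself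
  -- supplies one.
  · refine ⟨realization d.Q d.act₂ (d.belief r₀ q τ.first c) τ, isPlan_realization _ _ _ _ _
      Q_nonneg (belief_nonneg hr₀ hq _ c), ?_⟩
    rw [h, zero_smul]
    funext t l h' n
    refine sum_eq_zero fun l₀ _ => ?_
    rw [realization_cons]
    exact realization_of_eq_zero _ _ _ _
      (fun l' => by rw [mul_eq_zero_of_actProb hq h, zero_mul]) _ _ _ _
  · refine ⟨(actProb q τ.first (d.act₂ c))⁻¹ • (realization d.Q d.act₂ q τ).shift c, ?_,
      (smul_inv_smul₀ h _).symm⟩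
    have hs := ((isPlan_realization d.Q d.act₂ q τ (m + 1) Q_nonneg hq).shift c).smul
      (inv_nonneg.2 (actProb_nonneg (Y := τ.first) (c := d.act₂ c) hq))
    convert hs using 1
    funext l'
    rw [Pi.smul_apply, smul_eq_mul, eq_inv_mul_iff_mul_eq₀ h, belief, actProb_mul_nextBelief hq]
    simp only [realization_zero]

/-- An optimal strategy and the best replies to it solve the constraints with the value. -/
theorem exists_innerFeasible [Nonempty K] [Nonempty M] [Nonempty N] (m : ℕ) {r : L → ℝ}
    (hr : ∀ l, 0 ≤ r l) (β : K → ℝ) :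
    ∃ Z S, d.InnerFeasible m r β (d.value m β r) Z S := by
  classical
  obtain ⟨τ, hτ⟩ := d.exists_le_value m β hr
  obtain ⟨Z, σ, hZ, hs, hσ⟩ := d.exists_bestReply m (realization d.Q d.act₂ r τ)
  -- The horizon `m + 1` makes the initial equation available for `m = 0` too, since `flow_one` is
  -- required there.
  have h := isPlan_realization d.Q d.act₂ r τ (m + 1) Q_nonneg hr
  refine ⟨Z, _, fun k => ?_, hs, fun t ht => h.flow t (by omega), h.init m.succ_pos, hZ,
    fun t ht => h.nonneg t (by omega)⟩
  -- Starting in `k` and replying optimally earns `β k` plus the reply value at `k`, and the optimal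
  -- `τ` keeps this below the value.
  have hk := hτ (⟨Pi.single k 1, single_mem_stdSimplex ℝ k⟩, σ)
  rw [payoff, hσ _ (single_mem_stdSimplex ℝ k).1] at hk
  simpa [Pi.single_apply] using hk

/-- A strategy that realizes `S` guarantees `z₀`: starting from law `p`, the maximizer gets the
`p`-average of `β` plus at most the `p`-average of `z₀ - β`. -/
theorem InnerFeasible.value_le [Nonempty K] [Nonempty M] [Nonempty N] {d : PlanGame K L A B M N}
    {m : ℕ} {r : L → ℝ} {β : K → ℝ} {z₀ : ℝ}
    {Z : (t : ℕ) → (Fin (t + 1) → K) → (Fin t → A × B) → ℝ} {S : Plan L A B N}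
    (h : d.InnerFeasible m r β z₀ Z S) (hr : ∀ l, 0 ≤ r l) : d.value m β r ≤ z₀ := by
  obtain ⟨τ, hτ⟩ := h.isPlan.exists_realization
  refine d.value_le hr (τ := τ) fun x => ?_
  have hx := h.pay_le x.1.2.1 (isPlan_realization d.P d.act₁ x.1.1 x.2 m P_nonneg x.1.2.1)
  rw [payoff, d.pay_congr (fun _ _ => rfl) hτ]
  simp only [mul_sub, sum_sub_distrib, ← sum_mul, x.1.2.2, one_mul] at hx
  linarith

omit [Fintype A] [Fintype B] [Fintype M] [Fintype N] in
theorem sum_next_law (x : K → ℝ) (c : A × B) (z : ℝ) (β : K → ℝ) :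
    ∑ k', (∑ k, x k * d.P c k k') * (z - β k') = ∑ k, x k * (z - ∑ k', d.P c k k' * β k') := by
  simp only [sum_mul]
  rw [sum_comm]
  refine sum_congr rfl fun k _ => ?_
  have : z = ∑ k', d.P c k k' * z := by rw [← sum_mul, (d.P_mem c k).2, one_mul]
  conv_rhs => rw [this, ← sum_sub_distrib, mul_sum]
  exact sum_congr rfl fun k' _ => by ring

/-- Every feasible `ρ` is guaranteed by a strategy of the minimizer. -/
theorem Feasible.value_le [Nonempty K] [Nonempty M] [Nonempty N] {d : PlanGame K L A B M N}
    {m : ℕ} {r₀ : A × B → L → ℝ} {μ : K → ℝ} {q : L → ℝ} {Y : L → stdSimplex ℝ N}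
    {ρ : ℝ} {β : A × B → K → ℝ} {Z₀ : A × B → ℝ}
    {Z : A × B → (t : ℕ) → (Fin (t + 1) → K) → (Fin t → A × B) → ℝ}
    {S : A × B → Plan L A B N} (h : d.Feasible m r₀ μ q Y ρ β Z₀ Z S) (hq : ∀ l, 0 ≤ q l) :
    d.value (m + 1) μ q ≤ ρ := by
  choose τ hτ using fun c => (h.inner c).isPlan.exists_realization
  -- The continuation forgets the minimizer's first state. Nothing is lost, because `S c` is a plan
  -- from the belief after the first stage.
  refine d.value_le hq (τ := compose Y τ) fun x => ?_
  have hx := isPlan_realization d.P d.act₁ x.1.1 x.2 (m + 1) P_nonneg x.1.2.1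
  have hc (a : M) (b : N) :
      d.pay m ((realization d.P d.act₁ x.1.1 x.2).shift (d.e (a, b)))
        ((realization d.Q d.act₂ q (compose Y τ)).shift (d.e (a, b))) ≤
      ∑ k, x.1.1 k * (x.2.first k).1 a * (actProb q Y b *
        (Z₀ (d.e (a, b)) - ∑ k', d.P (d.e (a, b)) k k' * β (d.e (a, b)) k')) := by
    have e1 : ∀ t < m, (realization d.Q d.act₂ q (compose Y τ)).shift (d.e (a, b)) t =
        (actProb q Y b • S (d.e (a, b))) t := by
      intro t ht
      rw [shift_realization_compose, Pi.smul_apply, ← hτ (d.e (a, b)) t ht]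
      simp only [← actProb_mul_nextBelief (r₀ := r₀ (d.e (a, b))) hq]
      funext l h n
      rw [realization_smul, act₂_e]
      simp only [belief, act₂_e, Pi.smul_apply, smul_eq_mul]
    have e2 := (h.inner (d.e (a, b))).pay_le (fun k' => sum_nonneg fun k _ =>
      mul_nonneg (hx.nonneg 0 m.succ_pos _ _ _) (P_nonneg _ _ _)) (hx.shift (d.e (a, b)))
    rw [sum_next_law] at e2
    simp only [realization_zero, act₁_e] at e2
    rw [d.pay_congr (fun _ _ => rfl) e1, pay_smul_right]
    refine (mul_le_mul_of_nonneg_left e2 (actProb_nonneg hq)).trans_eq ?_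
    rw [mul_sum]
    exact sum_congr rfl fun k _ => by ring
  rw [payoff_succ]
  calc _ ≤ ∑ k, ∑ a, x.1.1 k * (x.2.first k).1 a *
        (μ k + ∑ l, ∑ b, d.G k l (d.e (a, b)) * (Y l).1 b * q l) +
      d.lam * ∑ a, ∑ b, ∑ k, x.1.1 k * (x.2.first k).1 a * (actProb q Y b *
        (Z₀ (d.e (a, b)) - ∑ k', d.P (d.e (a, b)) k k' * β (d.e (a, b)) k')) := by
        refine add_le_add le_rfl (mul_le_mul_of_nonneg_left ?_ d.lam_nonneg)
        exact sum_le_sum fun a _ => sum_le_sum fun b _ => hc a b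
    _ = ∑ k, ∑ a, x.1.1 k * (x.2.first k).1 a * d.stageCoeff μ q Y β Z₀ a k := by
        have e3 : ∀ F : M → N → K → ℝ, ∑ a, ∑ b, ∑ k, F a b k = ∑ k, ∑ a, ∑ b, F a b k := by
          intro F
          rw [sum_comm (γ := K)]
          exact sum_congr rfl fun a _ => sum_comm
        rw [e3, mul_sum, ← sum_add_distrib]
        refine sum_congr rfl fun k _ => ?_
        rw [mul_sum, ← sum_add_distrib]
        refine sum_congr rfl fun a _ => ?_
        rw [stageCoeff, ← mul_sum]
        ring
    _ ≤ ∑ k, ∑ a, x.1.1 k * (x.2.first k).1 a * ρ :=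
        sum_le_sum fun k _ => sum_le_sum fun a _ => mul_le_mul_of_nonneg_left (h.objective a k)
          (mul_nonneg (x.1.2.1 k) ((x.2.first k).2.1 a))
    _ = ρ := by
        simp only [← sum_mul, ← mul_sum, (x.2.first _).2.2, mul_one, x.1.2.2, one_mul]

/-- A strategy of the minimizer that guarantees `ρ` yields a feasible point. -/
theorem exists_feasible [Nonempty K] [Nonempty M] [Nonempty N] (m : ℕ) {r₀ : A × B → L → ℝ}
    (hr₀ : ∀ c l, 0 ≤ r₀ c l) (μ : K → ℝ) {q : L → ℝ} (hq : ∀ l, 0 ≤ q l)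
    {τ : BehaviorStrategy L A B N} {ρ : ℝ} (hτ : ∀ x, d.payoff (m + 1) μ q x τ ≤ ρ) :
    ∃ β Z₀ Z S, d.Feasible m r₀ μ q τ.first ρ β Z₀ Z S := by
  classical
  -- As before, `m + 1` secures the initial equation when `m = 0`.
  choose S hS hyS using d.exists_plan_of_strategy (m + 1) hr₀ hq τ
  choose Z σ hZ hs hσ using fun c => d.exists_bestReply m (S c)
  -- With `β` equal to minus the reply values and `Z₀ = 0`, the initial constraints hold with
  -- equality. The bound on `ρ` at `(a, k)` is the payoff of starting in `k`, playing `a` and then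
  -- replying optimally.
  refine ⟨fun c k => -Z c 0 (fun _ => k) Fin.elim0, 0, Z, S, fun a k => ?_, fun c =>
    ⟨fun k => (neg_add_cancel _).le, hs c, fun t ht => (hS c).flow t (by omega),
      (hS c).init m.succ_pos, hZ c, fun t ht => (hS c).nonneg t (by omega)⟩⟩
  refine le_of_eq_of_le ?_ (hτ (⟨Pi.single k 1, single_mem_stdSimplex ℝ k⟩,
    compose (fun _ => ⟨Pi.single a 1, single_mem_stdSimplex ℝ a⟩) σ))
  -- The factor `Pi.single a 1` removes all pairs whose maximizer action differs from `a`.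
  have hp (c : A × B) : d.pay m ((realization d.P d.act₁ (Pi.single k 1)
        (compose (fun _ => ⟨Pi.single a 1, single_mem_stdSimplex ℝ a⟩) σ)).shift c)
        ((realization d.Q d.act₂ q τ).shift c) =
      (Pi.single a 1 : M → ℝ) (d.act₁ c) * (actProb q τ.first (d.act₂ c) *
        ∑ k', d.P c k k' * Z c 0 (fun _ => k') Fin.elim0) := by
    have e1 : (fun k' => ∑ k₀, (Pi.single k 1 : K → ℝ) k₀ *
        (Pi.single a 1 : M → ℝ) (d.act₁ c) * d.P c k₀ k') =
        fun k' => (Pi.single a 1 : M → ℝ) (d.act₁ c) * d.P c k k' := by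
      funext k'
      rw [sum_eq_single k] <;> simp +contextual [Pi.single_apply]
    rw [hyS, pay_smul_right, shift_realization_compose, e1, hσ]
    · simp only [mul_sum]
      exact sum_congr rfl fun k' _ => by ring
    · exact fun k' => mul_nonneg ((single_mem_stdSimplex ℝ a).1 _) (P_nonneg _ _ _)
  rw [payoff_succ, stageCoeff]
  simp only [hp, act₁_e, act₂_e, compose_first]
  congr 1
  · rw [sum_eq_single k, sum_eq_single a] <;> simp +contextual [Pi.single_apply]
  · rw [sum_eq_single a] <;> simp +contextual

variable {m : ℕ} {r₀ : A × B → L → ℝ} {μ : K → ℝ} {q : L → ℝ}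

variable [Nonempty K] [Nonempty M] [Nonempty N]

/-- Any `Y` and `β` extend to a feasible point whose `Z₀` is the continuation value, by
`exists_innerFeasible`. The maximal objective is then a feasible `ρ`. -/
theorem value_le_of_isGreatest (hr₀ : ∀ c l, 0 ≤ r₀ c l) (hq : ∀ l, 0 ≤ q l)
    {Y : L → stdSimplex ℝ N} {β : A × B → K → ℝ} {ρ : ℝ}
    (h : IsGreatest (Set.range (d.stageObjective m r₀ μ q Y β)) ρ) :
    d.value (m + 1) μ q ≤ ρ := by
  choose Z S hZS using fun c => d.exists_innerFeasible m (belief_nonneg (d := d) hr₀ hq Y c) (β c)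
  refine Feasible.value_le (d := d) (Y := Y) (Z := Z) (S := S) ⟨fun a k => ?_, hZS⟩ hq
  exact h.2 (exists_vertex _ a k)

theorem isLeast_feasible (hr₀ : ∀ c l, 0 ≤ r₀ c l) (hq : ∀ l, 0 ≤ q l)
    {τ : BehaviorStrategy L A B N}
    (hτ : ∀ x, d.payoff (m + 1) μ q x τ ≤ d.value (m + 1) μ q) :
    IsLeast {ρ | ∃ β Z₀ Z S, d.Feasible m r₀ μ q τ.first ρ β Z₀ Z S} (d.value (m + 1) μ q) :=
  ⟨d.exists_feasible m hr₀ μ hq hτ, fun _ ⟨_, _, _, _, h⟩ => h.value_le hq⟩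

/-- Feasibility forces `Z₀` above the continuation value, so the one-stage maximum is at most the
value. The opposite inequality holds for every `β`. -/
theorem Feasible.isGreatest {d : PlanGame K L A B M N} (hr₀ : ∀ c l, 0 ≤ r₀ c l)
    (hq : ∀ l, 0 ≤ q l) {Y : L → stdSimplex ℝ N} {β : A × B → K → ℝ} {Z₀ : A × B → ℝ}
    {Z : A × B → (t : ℕ) → (Fin (t + 1) → K) → (Fin t → A × B) → ℝ} {S : A × B → Plan L A B N}
    (h : d.Feasible m r₀ μ q Y (d.value (m + 1) μ q) β Z₀ Z S) :
    IsGreatest (Set.range (d.stageObjective m r₀ μ q Y β)) (d.value (m + 1) μ q) := by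
  obtain ⟨a, k, hak⟩ := exists_isGreatest_linear
    (d.stageCoeff μ q Y β fun c => d.value m (β c) (d.belief r₀ q Y c))
  have h1 := d.value_le_of_isGreatest hr₀ hq hak
  have h2 : d.stageCoeff μ q Y β (fun c => d.value m (β c) (d.belief r₀ q Y c)) a k ≤
      d.value (m + 1) μ q := by
    refine le_trans ?_ (h.objective a k)
    refine add_le_add le_rfl (mul_le_mul_of_nonneg_left (sum_le_sum fun b _ => ?_) d.lam_nonneg)
    refine mul_le_mul_of_nonneg_left (sub_le_sub_right ?_ _) (actProb_nonneg hq)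
    exact (h.inner _).value_le (belief_nonneg hr₀ hq Y _)
  rw [le_antisymm h1 h2]
  exact hak

end PlanGame

/-! ### The two dual games as plan games -/

namespace BayesianGame

open BehaviorStrategy

variable {K L A B : Type*} [Fintype K] [Fintype L] [Fintype A] [Fintype B]

/-- The type 1 dual game in terms of plans: player 1 is the maximizer. -/
def planGame1 (g : BayesianGame K L A B) (lam : ℝ) (h : 0 ≤ lam) : PlanGame K L A B A B where
  e := Equiv.refl _
  P c := g.P c.1 c.2
  Q c := g.Q c.1 c.2
  G k l c := g.G k l c.1 c.2
  lam := lam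
  P_mem _ := g.P_mem _ _
  Q_mem _ := g.Q_mem _ _
  lam_nonneg := h

/-- The type 2 dual game in terms of plans: player 2 is the maximizer of the negative payoff. -/
def planGame2 (g : BayesianGame K L A B) (lam : ℝ) (h : 0 ≤ lam) : PlanGame L K A B B A where
  e := Equiv.prodComm B A
  P c := g.Q c.1 c.2
  Q c := g.P c.1 c.2
  G l k c := -g.G k l c.1 c.2
  lam := lam
  P_mem _ := g.Q_mem _ _
  Q_mem _ := g.P_mem _ _
  lam_nonneg := h

variable (g : BayesianGame K L A B) (lam : ℝ) (n : ℕ) (p : K → ℝ) (q : L → ℝ)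
  (σ : BehaviorStrategy K A B A) (τ : BehaviorStrategy L A B B)

theorem playProb_eq (k : Fin (n + 1) → K) (l : Fin (n + 1) → L) (h : Fin n → A × B) :
    g.playProb n p q σ τ k l h =
      reach (fun c => g.P c.1 c.2) Prod.fst p σ n k h *
        reach (fun c => g.Q c.1 c.2) Prod.snd q τ n l h := by
  rw [playProb, reach, reach, mul_mul_mul_comm, ← prod_mul_distrib]
  congr 1
  exact prod_congr rfl fun t _ => by ring

/-- The expected payoff is the sum of the expected stage payoffs. -/
theorem expectation_payoff (f : K → L → ℝ) :
    g.expectation n p q σ τ (fun k l h => f (k 0) (l 0) + g.totalPayoff lam n k l h) =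
      ∑ k, ∑ l, p k * q l * f k l + ∑ t ∈ range n, ∑ k, ∑ l, ∑ h, ∑ c : A × B,
        realization (fun c => g.P c.1 c.2) Prod.fst p σ t k h c.1 *
          realization (fun c => g.Q c.1 c.2) Prod.snd q τ t l h c.2 *
          (lam ^ t * g.G (k (Fin.last t)) (l (Fin.last t)) c.1 c.2) := by
  induction n with
  | zero =>
    simp only [expectation, playProb_eq, totalPayoff, reach_zero, range_zero, sum_empty, add_zero,
      Fin.sum_univ_zero]
    refine (sum_tuple_one _).trans (sum_congr rfl fun k _ => (sum_tuple_one _).trans ?_)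
    exact sum_congr rfl fun l _ => sum_tuple_zero _
  | succ n ih =>
    rw [sum_range_succ, ← add_assoc, ← ih]
    simp only [expectation, playProb_eq, ← sum_add_distrib]
    rw [sum_snoc_tuple]
    refine sum_congr rfl fun k _ => ?_
    have e1 (k' : K) (l : Fin (n + 1) → L) (l' : L) (h : Fin n → A × B) (c : A × B) :
        f (Fin.snoc (α := fun _ => K) k k' 0) (Fin.snoc (α := fun _ => L) l l' 0) +
          g.totalPayoff lam (n + 1) (Fin.snoc (α := fun _ => K) k k')
            (Fin.snoc (α := fun _ => L) l l') (Fin.snoc (α := fun _ => A × B) h c) =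
        f (k 0) (l 0) + g.totalPayoff lam n k l h +
          lam ^ n * g.G (k (Fin.last n)) (l (Fin.last n)) c.1 c.2 := by
      have h0 : Fin.snoc (α := fun _ => K) k k' 0 = k 0 :=
        Fin.snoc_castSucc (α := fun _ => K) k' k 0
      have h1 : Fin.snoc (α := fun _ => L) l l' 0 = l 0 :=
        Fin.snoc_castSucc (α := fun _ => L) l' l 0
      rw [h0, h1, totalPayoff, totalPayoff, Fin.sum_univ_castSucc]
      simp only [Fin.snoc_castSucc, Fin.snoc_last, Fin.val_castSucc, Fin.val_last]
      ring
    rw [sum_comm, sum_snoc_tuple]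
    refine sum_congr rfl fun l _ => ?_
    rw [sum_comm]
    have e2 : ∀ F : K → L → (Fin (n + 1) → A × B) → ℝ,
        ∑ k', ∑ l', ∑ h, F k' l' h =
          ∑ h : Fin n → A × B, ∑ c, ∑ k', ∑ l', F k' l' (Fin.snoc (α := fun _ => A × B) h c) := by
      intro F
      rw [← sum_snoc_tuple fun h => ∑ k', ∑ l', F k' l' h, sum_comm (γ := Fin (n + 1) → A × B)]
      exact sum_congr rfl fun k' _ => sum_comm
    rw [e2]
    refine sum_congr rfl fun h _ => ?_
    simp only [reach_snoc, e1]
    -- The states reached after the last paid stage carry no payoff, so their transition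
    -- probabilities sum to one.
    have e3 (c : A × B) (u v w : ℝ) : ∑ k', ∑ l', g.P c.1 c.2 (k (Fin.last n)) k' * u *
        (g.Q c.1 c.2 (l (Fin.last n)) l' * v) * w = u * v * w := by
      have : ∀ k' l', g.P c.1 c.2 (k (Fin.last n)) k' * u *
          (g.Q c.1 c.2 (l (Fin.last n)) l' * v) * w =
          g.P c.1 c.2 (k (Fin.last n)) k' * (g.Q c.1 c.2 (l (Fin.last n)) l' * (u * v * w)) :=
        fun k' l' => by ring
      simp only [this, ← mul_sum, ← sum_mul, (g.P_mem _ _ _).2, (g.Q_mem _ _ _).2, one_mul]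
    simp only [e3, mul_add _ (f _ _ + _), sum_add_distrib]
    congr 1
    rw [← sum_mul, ← sum_realization _ _ p, ← sum_realization _ _ q, sum_mul_sum,
      Fintype.sum_prod_type]

variable {g lam n p q}

theorem dualPayoff1_eq (h : 0 ≤ lam) (μ : K → ℝ) (hq : q ∈ stdSimplex ℝ L) :
    g.dualPayoff1 lam n μ q = (g.planGame1 lam h).payoff n μ q := by
  funext x τ
  rw [dualPayoff1, expectation_payoff g lam n x.1.1 q x.2 τ fun k _ => μ k, PlanGame.payoff]
  congr 1
  · refine sum_congr rfl fun k _ => ?_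
    rw [← sum_mul, ← mul_sum, hq.2, mul_one]
  · refine sum_congr rfl fun t _ => sum_congr rfl fun k _ => ?_
    rw [sum_comm]
    refine sum_congr rfl fun h' _ => ?_
    simp only [Fintype.sum_prod_type]
    rw [sum_comm]
    refine sum_congr rfl fun a _ => ?_
    simp only [PlanGame.stageReward, mul_sum]
    refine sum_congr rfl fun l _ => sum_congr rfl fun b _ => ?_
    change _ = realization (fun c => g.P c.1 c.2) Prod.fst x.1.1 x.2 t k h' a *
      (realization (fun c => g.Q c.1 c.2) Prod.snd q τ t l h' b * lam ^ t *
        g.G (k (Fin.last t)) (l (Fin.last t)) a b)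
    ring

theorem dualPayoff2_eq (h : 0 ≤ lam) (hp : p ∈ stdSimplex ℝ K) (ν : L → ℝ) :
    g.dualPayoff2 lam n p ν = fun σ y => -(g.planGame2 lam h).payoff n (-ν) p y σ := by
  funext σ y
  rw [dualPayoff2, expectation_payoff g lam n p y.1.1 σ y.2 fun _ l => ν l, PlanGame.payoff,
    neg_add]
  congr 1
  · rw [sum_comm, ← sum_neg_distrib]
    refine sum_congr rfl fun l _ => ?_
    rw [← sum_mul, ← sum_mul, hp.2, Pi.neg_apply]
    ring
  · rw [PlanGame.pay, ← sum_neg_distrib]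
    refine sum_congr rfl fun t _ => ?_
    rw [sum_comm, ← sum_neg_distrib]
    refine sum_congr rfl fun l _ => ?_
    rw [sum_comm, ← sum_neg_distrib]
    refine sum_congr rfl fun h' _ => ?_
    simp only [Fintype.sum_prod_type_right]
    rw [sum_comm, ← sum_neg_distrib]
    refine sum_congr rfl fun b _ => ?_
    simp only [PlanGame.stageReward, mul_sum, ← sum_neg_distrib]
    refine sum_congr rfl fun k _ => sum_congr rfl fun a _ => ?_
    change _ = -(realization (fun c => g.Q c.1 c.2) Prod.snd y.1.1 y.2 t l h' b *
      (realization (fun c => g.P c.1 c.2) Prod.fst p σ t k h' a * lam ^ t *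
        -g.G (k (Fin.last t)) (l (Fin.last t)) a b))
    ring

theorem w1_eq (h : 0 ≤ lam) (μ : K → ℝ) (hq : q ∈ stdSimplex ℝ L) :
    g.w1 lam n μ q = (g.planGame1 lam h).value n μ q := by
  rw [w1, dualPayoff1_eq h μ hq, PlanGame.value]

theorem w2_eq [Nonempty L] [Nonempty A] [Nonempty B] (h : 0 ≤ lam) (hp : p ∈ stdSimplex ℝ K)
    (ν : L → ℝ) : g.w2 lam n p ν = -(g.planGame2 lam h).value n (-ν) p := by
  rw [w2, dualPayoff2_eq h hp ν, PlanGame.gameValue_neg_payoff _ _ _ hp.1]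

end BayesianGame

/-- The translations `w1_eq` and `w2_eq` ask for probability laws, and the recursion evaluates them
at updated beliefs. -/
theorem nextBelief_mem {S C : Type*} [Fintype S] [Fintype C] {T : S → S → ℝ} {r : S → ℝ}
    {Y : S → stdSimplex ℝ C} {c : C} {r₀ : S → ℝ} (hT : ∀ s, T s ∈ stdSimplex ℝ S)
    (hr : r ∈ stdSimplex ℝ S) (hr₀ : r₀ ∈ stdSimplex ℝ S) :
    nextBelief T r Y c r₀ ∈ stdSimplex ℝ S := by
  refine ⟨nextBelief_nonneg (fun s => (hT s).1) hr.1 hr₀.1, ?_⟩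
  by_cases h : actProb r Y c = 0
  · simp only [nextBelief, if_pos h, hr₀.2]
  · refine mul_left_cancel₀ h ?_
    simp only [mul_sum, actProb_mul_nextBelief hr.1]
    rw [sum_comm]
    simp only [← mul_sum, (hT _).2, mul_one]
    rfl

/-- The continuation term does not depend on the hidden state. This reconciles the double sum in the
linear program with the weights `actProb` in `stageCoeff`. -/
theorem sum_mul_eq_sum_actProb {S C : Type*} [Fintype S] [Fintype C] (r : S → ℝ)
    (Y : S → stdSimplex ℝ C) (F : C → ℝ) :
    ∑ s, ∑ c, (Y s).1 c * r s * F c = ∑ c, actProb r Y c * F c := by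
  rw [sum_comm]
  refine sum_congr rfl fun c _ => ?_
  rw [actProb, sum_mul]
  exact sum_congr rfl fun s _ => by ring

/-! ### Translation of the linear programs and one-stage problems -/

namespace BayesianGame

variable {K L A B : Type*} [Fintype K] [Fintype L] [Fintype A] [Fintype B]
  {g : BayesianGame K L A B} {lam : ℝ} {m : ℕ} {p : K → ℝ} {q : L → ℝ}

omit [Fintype A] in
theorem feasible1_iff (h : 0 ≤ lam) {q₀ : A → B → L → ℝ} {μ : K → ℝ} {Y : L → stdSimplex ℝ B}
    {ρ : ℝ} {β : A × B → K → ℝ} {Z₀ : A × B → ℝ}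
    {Z : A × B → (t : ℕ) → (Fin (t + 1) → K) → (Fin t → A × B) → ℝ}
    {S : A × B → Plan L A B B} :
    g.Feasible1 lam (m + 1) q₀ μ q Y ρ (fun a b => β (a, b)) (fun a b => Z₀ (a, b))
        (fun a b => Z (a, b)) (fun a b => S (a, b)) ↔
      (g.planGame1 lam h).Feasible m (fun c => q₀ c.1 c.2) μ q Y ρ β Z₀ Z S := by
  have hc (a : A) (k : K) :
      μ k + ∑ l, ∑ b, g.G k l a b * (Y l).1 b * q l +
        lam * ∑ l, ∑ b, (Y l).1 b * q l * (Z₀ (a, b) - ∑ k', g.P a b k k' * β (a, b) k') =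
      (g.planGame1 lam h).stageCoeff μ q Y β Z₀ a k := by
    rw [sum_mul_eq_sum_actProb]
    rfl
  constructor
  · intro H
    exact ⟨fun a k => (hc a k).symm.trans_le (H.objective a k), fun c =>
      ⟨H.initial c.1 c.2, fun t ht => H.step c.1 c.2 t (by omega),
        fun t ht l h' c' => H.flow c.1 c.2 t (by omega) l h' c'.1 c'.2,
        H.flow_one c.1 c.2, H.terminal c.1 c.2, fun t ht => H.nonneg c.1 c.2 t (by omega)⟩⟩
  · intro H
    exact ⟨fun a k => (hc a k).trans_le (H.objective a k), fun a b => (H.inner (a, b)).initial,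
      fun a b t ht => (H.inner (a, b)).step t (by omega),
      fun a b t ht l h' a' b' => (H.inner (a, b)).flow t (by omega) l h' (a', b'),
      fun a b => (H.inner (a, b)).flow_one, fun a b => (H.inner (a, b)).terminal,
      fun a b t ht => (H.inner (a, b)).nonneg t (by omega)⟩

theorem stageObjective1_eq (h : 0 ≤ lam) {q₀ : A → B → L → ℝ}
    (hq₀ : ∀ a b, q₀ a b ∈ stdSimplex ℝ L) (μ : K → ℝ) (hq : q ∈ stdSimplex ℝ L)
    (Y : L → stdSimplex ℝ B) (β : A → B → K → ℝ) :
    g.stageObjective1 lam q₀ (g.w1 lam m) μ q Y β =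
      (g.planGame1 lam h).stageObjective m (fun c => q₀ c.1 c.2) μ q Y fun c => β c.1 c.2 := by
  have hw (a : A) (b : B) : g.w1 lam m (β a b) (g.qNext q₀ q Y a b) =
      (g.planGame1 lam h).value m (β a b) (g.qNext q₀ q Y a b) :=
    w1_eq h _ (nextBelief_mem (g.Q_mem a b) hq (hq₀ a b))
  funext Pi
  simp only [stageObjective1, hw]
  rfl

theorem isVectorPayoff1_of_feasible [Nonempty K] [Nonempty A] [Nonempty B] (h : 0 ≤ lam)
    {q₀ : A → B → L → ℝ} (hq₀ : ∀ a b, q₀ a b ∈ stdSimplex ℝ L) {μ : K → ℝ}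
    (hq : q ∈ stdSimplex ℝ L) {Y : L → stdSimplex ℝ B} {β : A → B → K → ℝ} {Z₀ : A → B → ℝ}
    {Z : A → B → (t : ℕ) → (Fin (t + 1) → K) → (Fin t → A × B) → ℝ}
    {S : A → B → Plan L A B B}
    (H : g.Feasible1 lam (m + 1) q₀ μ q Y (g.w1 lam (m + 1) μ q) β Z₀ Z S) :
    g.IsVectorPayoff1 lam (m + 1) q₀ μ q Y β := by
  have H' := (feasible1_iff h (β := fun c => β c.1 c.2) (Z₀ := fun c => Z₀ c.1 c.2)
    (Z := fun c => Z c.1 c.2) (S := fun c => S c.1 c.2)).1 H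
  have hr₀ (c : A × B) : ∀ l, 0 ≤ q₀ c.1 c.2 l := (hq₀ c.1 c.2).1
  have key : IsGreatest (Set.range (g.stageObjective1 lam q₀ (g.w1 lam m) μ q Y β))
      (g.w1 lam (m + 1) μ q) := by
    rw [stageObjective1_eq h hq₀ μ hq]
    rw [w1_eq h μ hq] at H' ⊢
    exact H'.isGreatest hr₀ hq.1
  refine ⟨⟨⟨Y, β, key⟩, ?_⟩, key⟩
  rintro r ⟨Y', β', hr⟩
  rw [Nat.add_sub_cancel, stageObjective1_eq h hq₀ μ hq] at hr
  rw [w1_eq h μ hq]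
  exact (g.planGame1 lam h).value_le_of_isGreatest hr₀ hq.1 hr

-- Exchanging the players negates every payoff-valued variable, while `R` consists of probability
-- weights and keeps its sign.
omit [Fintype B] in
theorem feasible2_iff (h : 0 ≤ lam) {p₀ : A → B → K → ℝ} {ν : L → ℝ} {X : K → stdSimplex ℝ A}
    {φ : ℝ} {α : A × B → L → ℝ} {U₀ : A × B → ℝ}
    {U : A × B → (t : ℕ) → (Fin (t + 1) → L) → (Fin t → A × B) → ℝ}
    {R : A × B → Plan K A B A} :
    g.Feasible2 lam (m + 1) p₀ p ν X φ (fun a b => α (a, b)) (fun a b => U₀ (a, b))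
        (fun a b => U (a, b)) (fun a b => R (a, b)) ↔
      (g.planGame2 lam h).Feasible m (fun c => p₀ c.1 c.2) (-ν) p X (-φ) (-α) (-U₀) (-U) R := by
  have hc (b : B) (l : L) :
      ν l + ∑ k, ∑ a, g.G k l a b * (X k).1 a * p k +
        lam * ∑ k, ∑ a, (X k).1 a * p k * (U₀ (a, b) - ∑ l', g.Q a b l l' * α (a, b) l') =
      -(g.planGame2 lam h).stageCoeff (-ν) p X (-α) (-U₀) b l := by
    rw [sum_mul_eq_sum_actProb]
    simp only [PlanGame.stageCoeff, planGame2, Equiv.coe_prodComm, Prod.swap, Pi.neg_apply,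
      neg_mul, mul_neg, sum_neg_distrib, neg_add, neg_neg, sub_neg_eq_add, mul_sub, mul_add,
      sum_add_distrib, sum_sub_distrib]
    ring
  have hs (c : A × B) (t : ℕ) (l : Fin (t + 1) → L) (h' : Fin t → A × B) (b' : B) :
      ∑ k : Fin (t + 1) → K, ∑ a', R c t k h' a' * lam ^ t *
          g.G (k (Fin.last t)) (l (Fin.last t)) a' b' +
        ∑ l', ∑ a', g.Q a' b' (l (Fin.last t)) l' *
          U c (t + 1) (Fin.snoc (α := fun _ => L) l l')
            (Fin.snoc (α := fun _ => A × B) h' (a', b')) =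
      -((g.planGame2 lam h).stageReward (R c) t l h' b' +
        (g.planGame2 lam h).contValue ((-U) c) t l h' b') := by
    simp only [PlanGame.stageReward, PlanGame.contValue, planGame2, Equiv.coe_prodComm, Prod.swap,
      Pi.neg_apply, mul_neg, sum_neg_distrib, neg_add, neg_neg]
  constructor
  · intro H
    refine ⟨fun b l => ?_, fun c =>
      ⟨fun l => ?_, fun t ht l h' b' => ?_,
        fun t ht k h' c' => H.flow c.1 c.2 t (by omega) k h' c'.1 c'.2,
        H.flow_one c.1 c.2, fun l h' => neg_eq_zero.2 (H.terminal c.1 c.2 l h'),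
        fun t ht => H.nonneg c.1 c.2 t (by omega)⟩⟩
    · exact le_neg.1 ((H.objective b l).trans_eq (hc b l))
    · have := H.initial c.1 c.2 l
      simp only [Pi.neg_apply]
      linarith
    · exact le_neg.1 ((H.step c.1 c.2 t (by omega) l h' b').trans_eq (hs c t l h' b'))
  · intro H
    refine ⟨fun b l => (le_neg.2 (H.objective b l)).trans_eq (hc b l).symm, fun a b l => ?_,
      fun a b t ht l h' b' => (le_neg.2 ((H.inner (a, b)).step t (by omega) l h' b')).trans_eq
        (hs (a, b) t l h' b').symm,
      fun a b t ht k h' a' b' => (H.inner (a, b)).flow t (by omega) k h' (a', b'),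
      fun a b => (H.inner (a, b)).flow_one,
      fun a b l h' => neg_eq_zero.1 ((H.inner (a, b)).terminal l h'),
      fun a b t ht => (H.inner (a, b)).nonneg t (by omega)⟩
    have := (H.inner (a, b)).initial l
    simp only [Pi.neg_apply] at this
    linarith

theorem stageObjective2_eq [Nonempty L] [Nonempty A] [Nonempty B] (h : 0 ≤ lam)
    {p₀ : A → B → K → ℝ} (hp₀ : ∀ a b, p₀ a b ∈ stdSimplex ℝ K) (hp : p ∈ stdSimplex ℝ K)
    (ν : L → ℝ) (X : K → stdSimplex ℝ A) (α : A → B → L → ℝ) (Psi : stdSimplex ℝ (B × L)) :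
    g.stageObjective2 lam p₀ (g.w2 lam m) p ν X α Psi =
      -(g.planGame2 lam h).stageObjective m (fun c => p₀ c.1 c.2) (-ν) p X
        (-fun c => α c.1 c.2) Psi := by
  have hw (a : A) (b : B) : g.w2 lam m (g.pNext p₀ p X a b) (α a b) =
      -(g.planGame2 lam h).value m (-α a b) (g.pNext p₀ p X a b) :=
    w2_eq h (nextBelief_mem (g.P_mem a b) hp (hp₀ a b)) _
  simp only [stageObjective2, hw, PlanGame.stageObjective, ← sum_neg_distrib, ← mul_neg]
  refine sum_congr rfl fun b _ => sum_congr rfl fun l _ => ?_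
  congr 1
  have hb (a : A) : (g.planGame2 lam h).belief (fun c => p₀ c.1 c.2) p X (a, b) =
      g.pNext p₀ p X a b := rfl
  have he (a : A) : (g.planGame2 lam h).e (b, a) = (a, b) := rfl
  simp only [PlanGame.stageCoeff, he, hb]
  simp only [planGame2, Pi.neg_apply, neg_mul, mul_neg, sum_neg_distrib, neg_add, neg_neg,
    sub_neg_eq_add, mul_sub, mul_add, sum_add_distrib, sum_sub_distrib]
  ring

theorem isLeast_range_iff_neg {ι : Type*} {f f' : ι → ℝ} (hf : ∀ i, f i = -f' i) {w : ℝ} :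
    IsLeast (Set.range f) w ↔ IsGreatest (Set.range f') (-w) := by
  refine and_congr ?_ ?_
  · simp only [Set.mem_range, hf, neg_eq_iff_eq_neg]
  · rw [mem_lowerBounds, mem_upperBounds, Set.forall_mem_range, Set.forall_mem_range]
    simp only [hf, le_neg]

theorem isVectorPayoff2_of_feasible [Nonempty L] [Nonempty A] [Nonempty B] (h : 0 ≤ lam)
    {p₀ : A → B → K → ℝ} (hp₀ : ∀ a b, p₀ a b ∈ stdSimplex ℝ K) {ν : L → ℝ}
    (hp : p ∈ stdSimplex ℝ K) {X : K → stdSimplex ℝ A} {α : A → B → L → ℝ} {U₀ : A → B → ℝ}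
    {U : A → B → (t : ℕ) → (Fin (t + 1) → L) → (Fin t → A × B) → ℝ}
    {R : A → B → Plan K A B A}
    (H : g.Feasible2 lam (m + 1) p₀ p ν X (g.w2 lam (m + 1) p ν) α U₀ U R) :
    g.IsVectorPayoff2 lam (m + 1) p₀ p ν X α := by
  have H' := (feasible2_iff h (α := fun c => α c.1 c.2) (U₀ := fun c => U₀ c.1 c.2)
    (U := fun c => U c.1 c.2) (R := fun c => R c.1 c.2)).1 H
  have hr₀ (c : A × B) : ∀ k, 0 ≤ p₀ c.1 c.2 k := (hp₀ c.1 c.2).1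
  have key : IsLeast (Set.range (g.stageObjective2 lam p₀ (g.w2 lam m) p ν X α))
      (g.w2 lam (m + 1) p ν) := by
    rw [isLeast_range_iff_neg (stageObjective2_eq h hp₀ hp ν X α)]
    rw [w2_eq h hp ν, neg_neg] at H' ⊢
    exact H'.isGreatest hr₀ hp.1
  refine ⟨⟨⟨X, α, key⟩, ?_⟩, key⟩
  rintro r ⟨X', α', hr⟩
  rw [Nat.add_sub_cancel, isLeast_range_iff_neg (stageObjective2_eq h hp₀ hp ν X' α')] at hr
  rw [w2_eq h hp ν]
  exact le_neg.1 ((g.planGame2 lam h).value_le_of_isGreatest hr₀ hp.1 hr)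

end BayesianGame

theorem mainTheorem3 {K L A B : Type*} [Fintype K] [Fintype L] [Fintype A] [Fintype B]
    [Nonempty K] [Nonempty L] [Nonempty A] [Nonempty B]
    (g : BayesianGame K L A B) (lam : ℝ) (hlam₀ : 0 < lam) (hlam₁ : lam ≤ 1) :
    -- the type 1 and type 2 dual games have values, with optimal strategies
    (∀ (m : ℕ) (μ : K → ℝ), ∀ q ∈ stdSimplex ℝ L,
      IsGameValue (g.dualPayoff1 lam m μ q) (g.w1 lam m μ q)) ∧
    (∀ (m : ℕ), ∀ p ∈ stdSimplex ℝ K, ∀ ν : L → ℝ,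
      IsGameValue (g.dualPayoff2 lam m p ν) (g.w2 lam m p ν)) ∧
    -- type 1 dual game
    (∀ (n : ℕ), 1 ≤ n → ∀ (μ : K → ℝ), ∀ q ∈ stdSimplex ℝ L,
      ∀ q₀ : A → B → L → ℝ, (∀ a b, q₀ a b ∈ stdSimplex ℝ L) →
      ∀ τ : BehaviorStrategy L A B B, IsOptimalForMin (g.dualPayoff1 lam n μ q) τ →
        IsLeast {ρ | ∃ β Z₀ Z S, g.Feasible1 lam n q₀ μ q τ.first ρ β Z₀ Z S}
          (g.w1 lam n μ q) ∧
        ∀ ρ β Z₀ Z S, g.Feasible1 lam n q₀ μ q τ.first ρ β Z₀ Z S →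
          (∀ ρ' β' Z₀' Z' S', g.Feasible1 lam n q₀ μ q τ.first ρ' β' Z₀' Z' S' → ρ ≤ ρ') →
          g.IsVectorPayoff1 lam n q₀ μ q τ.first β) ∧
    -- type 2 dual game
    (∀ (n : ℕ), 1 ≤ n → ∀ p ∈ stdSimplex ℝ K, ∀ ν : L → ℝ,
      ∀ p₀ : A → B → K → ℝ, (∀ a b, p₀ a b ∈ stdSimplex ℝ K) →
      ∀ σ : BehaviorStrategy K A B A, IsOptimalForMax (g.dualPayoff2 lam n p ν) σ →
        IsGreatest {φ | ∃ α U₀ U R, g.Feasible2 lam n p₀ p ν σ.first φ α U₀ U R}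
          (g.w2 lam n p ν) ∧
        ∀ φ α U₀ U R, g.Feasible2 lam n p₀ p ν σ.first φ α U₀ U R →
          (∀ φ' α' U₀' U' R', g.Feasible2 lam n p₀ p ν σ.first φ' α' U₀' U' R' → φ' ≤ φ) →
          g.IsVectorPayoff2 lam n p₀ p ν σ.first α) := by
  have h := hlam₀.le
  refine ⟨fun m μ q hq => ?_, fun m p hp ν => ?_, fun n hn μ q hq q₀ hq₀ τ hτ => ?_,
    fun n hn p hp ν p₀ hp₀ σ hσ => ?_⟩
  · rw [BayesianGame.w1_eq h μ hq, BayesianGame.dualPayoff1_eq h μ hq]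
    exact (g.planGame1 lam h).isGameValue_payoff m μ hq.1
  · rw [BayesianGame.w2_eq h hp ν, BayesianGame.dualPayoff2_eq h hp ν]
    exact (g.planGame2 lam h).isGameValue_neg_payoff m (-ν) hp.1
  · obtain ⟨m, rfl⟩ : ∃ m, n = m + 1 := ⟨n - 1, by omega⟩
    have hopt (x) : (g.planGame1 lam h).payoff (m + 1) μ q x τ ≤
        (g.planGame1 lam h).value (m + 1) μ q := by
      rw [← BayesianGame.w1_eq h μ hq, ← BayesianGame.dualPayoff1_eq h μ hq]
      exact hτ.2 ⟨x, rfl⟩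
    have hleast : IsLeast {ρ | ∃ β Z₀ Z S, g.Feasible1 lam (m + 1) q₀ μ q τ.first ρ β Z₀ Z S}
        (g.w1 lam (m + 1) μ q) := by
      obtain ⟨⟨β, Z₀, Z, S, hf⟩, hlow⟩ := (g.planGame1 lam h).isLeast_feasible
        (r₀ := fun c => q₀ c.1 c.2) (fun c => (hq₀ c.1 c.2).1) hq.1 hopt
      rw [BayesianGame.w1_eq h μ hq]
      refine ⟨⟨_, _, _, _, (BayesianGame.feasible1_iff h).2 hf⟩, ?_⟩
      rintro ρ ⟨β, Z₀, Z, S, hf⟩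
      exact hlow ⟨_, _, _, _, (BayesianGame.feasible1_iff h (β := fun c => β c.1 c.2)
        (Z₀ := fun c => Z₀ c.1 c.2) (Z := fun c => Z c.1 c.2) (S := fun c => S c.1 c.2)).1 hf⟩
    refine ⟨hleast, fun ρ β Z₀ Z S hf hmin => ?_⟩
    -- An optimal `ρ` is the attained minimum, hence the value; only feasibility at the value is
    -- needed from here on.
    obtain rfl : ρ = g.w1 lam (m + 1) μ q := by
      obtain ⟨β', Z₀', Z', S', hf'⟩ := hleast.1
      exact le_antisymm (hmin _ _ _ _ _ hf') (hleast.2 ⟨_, _, _, _, hf⟩)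
    exact BayesianGame.isVectorPayoff1_of_feasible h hq₀ hq hf
  · obtain ⟨m, rfl⟩ : ∃ m, n = m + 1 := ⟨n - 1, by omega⟩
    have hopt (y) : (g.planGame2 lam h).payoff (m + 1) (-ν) p y σ ≤
        (g.planGame2 lam h).value (m + 1) (-ν) p := by
      have := hσ.2 ⟨y, rfl⟩
      rw [← BayesianGame.w2, BayesianGame.w2_eq h hp ν, BayesianGame.dualPayoff2_eq h hp ν] at this
      exact neg_le_neg_iff.1 this
    have hgreatest : IsGreatest
        {φ | ∃ α U₀ U R, g.Feasible2 lam (m + 1) p₀ p ν σ.first φ α U₀ U R}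
        (g.w2 lam (m + 1) p ν) := by
      obtain ⟨⟨β, Z₀, Z, S, hf⟩, hlow⟩ := (g.planGame2 lam h).isLeast_feasible
        (r₀ := fun c => p₀ c.1 c.2) (fun c => (hp₀ c.1 c.2).1) hp.1 hopt
      rw [BayesianGame.w2_eq h hp ν]
      refine ⟨⟨_, _, _, _, (BayesianGame.feasible2_iff h (α := -β) (U₀ := -Z₀) (U := -Z) (R := S)).2
        (by simpa only [neg_neg] using hf)⟩, ?_⟩
      rintro φ ⟨α, U₀, U, R, hf⟩
      exact le_neg.1 (hlow ⟨_, _, _, _, (BayesianGame.feasible2_iff h (α := fun c => α c.1 c.2)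
        (U₀ := fun c => U₀ c.1 c.2) (U := fun c => U c.1 c.2) (R := fun c => R c.1 c.2)).1 hf⟩)
    refine ⟨hgreatest, fun φ α U₀ U R hf hmax => ?_⟩
    obtain rfl : φ = g.w2 lam (m + 1) p ν := by
      obtain ⟨α', U₀', U', R', hf'⟩ := hgreatest.1
      exact le_antisymm (hgreatest.2 ⟨_, _, _, _, hf⟩) (hmax _ _ _ _ _ hf')
    exact BayesianGame.isVectorPayoff2_of_feasible h hp₀ hp hf
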